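/- Let $E$ be an elliptic curve over $\mathbb{Q}$ with conductor $N_E$, let $d\ge 1$ be an integer, and let $K=\mathbb{Q}(\sqrt{-d})$ be the corresponding imaginary quadratic field. A prime number $p$ is called $K$-anomalous (for $E$) if the base change of $E$ to $K$ has good reduction at the primes of $K$ above $p$ and, for some prime $v\mid p$ of $K$ with residue field $k_v$, the reduction satisfies $\widetilde{E}(k_v)[p]\neq 0$. The curve $E$ is called $K$-Ridgdill if it has only finitely many $K$-anomalous primes. Let $\ell$ be a prime with $E(\mathbb{Q})[\ell]\neq 0$, and suppose that either 1. $\ell=2$, or 2. $\ell=3$ and $K=\mathbb{Q}(\sqrt{-3})$. Then $E$ is $K$-Ridgdill. Furthermore, no prime $p\ge 7$ that is coprime to $N_E\,d$ is $K$-anomalous. -/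

import Mathlib

open NumberField IsDedekindDomain

noncomputable section

namespace Ridgdill

/-! ### The conductor of an elliptic curve over `ℚ` -/

section Conductor

variable (p : ℕ) [Fact p.Prime]

/-- For a finite extension `L` of `ℚ_p` with ring of integers `𝒪`, the maximal ideal of `𝒪`,
written as the radical of `p𝒪`. -/
def maximalIdealAt (L : Type*) [Field L] [Algebra ℤ_[p] L] : Ideal (integralClosure ℤ_[p] L) :=
  (Ideal.span {(p : integralClosure ℤ_[p] L)}).radical

/-- For a finite Galois extension `L / ℚ_p` with ring of integers `𝒪` and maximal ideal `𝔓`, the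
`i`-th ramification group in the lower numbering,
`G_i = {σ ∈ Gal(L / ℚ_p) | σ x ≡ x mod 𝔓 ^ (i + 1) for all x ∈ 𝒪}`. -/
def ramificationSubset (L : Type*) [Field L] [Algebra ℚ_[p] L] [Algebra ℤ_[p] L] (i : ℕ) :
    Set (L ≃ₐ[ℚ_[p]] L) :=
  {σ | ∀ x : integralClosure ℤ_[p] L,
    ∃ y ∈ maximalIdealAt p L ^ (i + 1), (y : L) = σ (x : L) - (x : L)}

variable (E : WeierstrassCurve ℚ_[p]) (ℓ : ℕ)

open Classical in
/-- The field `ℚ_p(E[ℓ])` generated over `ℚ_p` by the coordinates of the `ℓ`-torsion points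
of `E` over an algebraic closure. -/
def torsionField : IntermediateField ℚ_[p] (AlgebraicClosure ℚ_[p]) :=
  IntermediateField.adjoin ℚ_[p]
    {z | ∃ (x y : AlgebraicClosure ℚ_[p])
      (h : (E.baseChange (AlgebraicClosure ℚ_[p])).toAffine.Nonsingular x y),
      ℓ • WeierstrassCurve.Affine.Point.some x y h = 0 ∧ (z = x ∨ z = y)}

open Classical in
/-- The points of `E[ℓ]`, all of which are defined over `L = ℚ_p(E[ℓ])`, that are fixed by every
element of a set `G` of elements of `Gal(L / ℚ_p)`. -/
def fixedTorsion (G : Set (torsionField p E ℓ ≃ₐ[ℚ_[p]] torsionField p E ℓ)) :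
    Set (E.baseChange (torsionField p E ℓ)).toAffine.Point :=
  {P | ℓ • P = 0 ∧
    ∀ σ ∈ G, WeierstrassCurve.Affine.Point.map (W' := E) σ.toAlgHom P = P}

/-- The dimension over `𝔽_ℓ` of `E[ℓ] / E[ℓ]^{G_i}`. -/
def torsionCodim (i : ℕ) : ℕ :=
  Nat.log ℓ (Nat.card (fixedTorsion p E ℓ ∅) /
    Nat.card (fixedTorsion p E ℓ (ramificationSubset p (torsionField p E ℓ) i)))

/-- The wild part of the exponent of the conductor,
`δ = ∑_{i ≥ 1} (#G_i / #G_0) · dim_{𝔽_ℓ} (E[ℓ] / E[ℓ]^{G_i})`, for an auxiliary prime `ℓ ≠ p`,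
where `G_i` are the ramification groups of `ℚ_p(E[ℓ]) / ℚ_p`. It does not depend on `ℓ`, and it is
an integer, so that the division of natural numbers is exact. -/
def wildExponent : ℕ :=
  let ℓ := if p = 2 then 3 else 2
  let G := ramificationSubset p (torsionField p E ℓ)
  (∑ᶠ i : ℕ, Nat.card (G (i + 1)) * torsionCodim p E ℓ (i + 1)) / Nat.card (G 0)

open Classical in
/-- The exponent of the conductor of an elliptic curve over `ℚ_p`: it is `0`, `1`, `2 + δ` when
the reduction is good, multiplicative, additive respectively. -/
def conductorExponent : ℕ :=
  if (E.minimal ℤ_[p]).HasGoodReduction ℤ_[p] then 0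
  else if (E.minimal ℤ_[p]).HasMultiplicativeReduction ℤ_[p] then 1
  else 2 + wildExponent p E

end Conductor

/-- The conductor `N_E = ∏_p p ^ {f_p}` of an elliptic curve `E` over `ℚ`. -/
def conductor (E : WeierstrassCurve ℚ) : ℕ :=
  ∏ᶠ p : Nat.Primes,
    haveI : Fact (p : ℕ).Prime := ⟨p.2⟩
    (p : ℕ) ^ conductorExponent p (E.baseChange ℚ_[p])

/-! ### Anomalous primes -/

section Anomalous

variable {K : Type*} [Field K] [NumberField K] (E : WeierstrassCurve K)

/-- A minimal Weierstrass equation of `E` at the prime `v` of the number field `K`. -/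
def minimalAt (v : HeightOneSpectrum (𝓞 K)) : WeierstrassCurve (v.adicCompletion K) :=
  (E.baseChange (v.adicCompletion K)).minimal (v.adicCompletionIntegers K)

instance (v : HeightOneSpectrum (𝓞 K)) :
    (minimalAt E v).IsMinimal (v.adicCompletionIntegers K) := by
  unfold minimalAt
  infer_instance

/-- `E` has good reduction at the prime `v` of the number field `K`. -/
def HasGoodReductionAt (v : HeightOneSpectrum (𝓞 K)) : Prop :=
  (minimalAt E v).HasGoodReduction (v.adicCompletionIntegers K)

/-- The reduction of `E` at `v`, a Weierstrass curve over the residue field `k_v`. -/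
def reductionAt (v : HeightOneSpectrum (𝓞 K)) :
    WeierstrassCurve (IsLocalRing.ResidueField (v.adicCompletionIntegers K)) :=
  (minimalAt E v).reduction (v.adicCompletionIntegers K)

open Classical in
/-- For an elliptic curve `E` over the number field `K`, the prime `p` is `K`-anomalous if `E` has
good reduction at (the primes above) `p` and the group of `k_v`-points of the reduction of `E` has
a nonzero `p`-torsion point for some prime `v ∣ p`. -/
def IsAnomalous (p : ℕ) : Prop :=
  p.Prime ∧
  (∀ v : HeightOneSpectrum (𝓞 K), (p : 𝓞 K) ∈ v.asIdeal → HasGoodReductionAt E v) ∧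
  ∃ v : HeightOneSpectrum (𝓞 K), (p : 𝓞 K) ∈ v.asIdeal ∧
    ∃ P : (reductionAt E v).toAffine.Point, P ≠ 0 ∧ p • P = 0

end Anomalous

/-- An elliptic curve over `ℚ` is `K`-Ridgdill if it has finitely many `K`-anomalous primes. -/
def IsRidgdill (E : WeierstrassCurve ℚ) (K : Type*) [Field K] [NumberField K] : Prop :=
  {p : ℕ | IsAnomalous (E.baseChange K) p}.Finite

/-- `K = ℚ(√-d)`. -/
def IsAdjoinSqrtNeg (d : ℕ) (K : Type*) [Field K] [NumberField K] : Prop :=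
  ∃ α : K, α ^ 2 = -(d : K) ∧ IntermediateField.adjoin ℚ {α} = ⊤

end Ridgdill

end

/-! Let `p ≥ 7` be prime to `d`, let `v ∣ p` be a prime of good reduction and `k = k_v`. Since `p`
is unramified in `K`, the reduction at `v` is, up to an isomorphism over `k`, a curve `y² = x³ + ax
+ b` over `𝔽_p` obtained by reducing a short model of `E` over `ℚ`. Its `p`-Frobenius `φ` on `k`
satisfies `φ² = 1`.

If `P` is a nonzero `p`-torsion point over `k`, then either `P + φP` is a nonzero point fixed by
`φ`, or `φP = -P`. So `p` divides the order of one of the groups `{φP = εP}`, `ε = ±1`: the points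
over `𝔽_p`, or those of a quadratic twist. Every `x ∈ 𝔽_p` carries at most two points of such a
group, so its order is at most `2p + 1`; Hasse's bound is not needed.

For `ℓ = 3`, the order is divisible by `3`. This is clear for `ε = 1`. If `φ ≠ 1` on `k`, then `p ≡
2 mod 3`, because `-3` is not a square mod `p`; the two orders add up to `2p + 2 ≡ 0 mod 3`, which
gives `ε = -1`. Hence `3p ≤ 2p + 1`, a contradiction.

For `ℓ = 2`, the point `(x₀, 0)` lies in both groups and `x₀` carries only one point, so the order
is at most `2p` and is divisible by `2p`. Equality forces `x³ + ax + b` to have the same nonzero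
quadratic character at every `x ≠ x₀`, which `ZMod.not_forall_pow_half_eq` excludes.

Finiteness follows, as only primes below `7` or dividing the nonzero integer `N_E d` remain. -/

namespace WeierstrassCurve

/-! ### Transport of torsion points along a change of variables -/

section VariableChangePoints

variable {F : Type*} [Field F] (C : VariableChange F) (W : WeierstrassCurve F)

theorem equation_of_variableChange {x y : F} (h : (C • W).toAffine.Equation x y) :
    W.toAffine.Equation (C.u ^ 2 * x + C.r) (C.u ^ 3 * y + C.u ^ 2 * C.s * x + C.t) := by
  have hu : (C.u : F) ≠ 0 := C.u.ne_zero
  rw [Affine.equation_iff] at h ⊢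
  simp only [variableChange_def, Units.val_inv_eq_inv_val] at h
  field_simp at h
  linear_combination h

theorem variableChange_negY (x y : F) :
    W.toAffine.negY (C.u ^ 2 * x + C.r) (C.u ^ 3 * y + C.u ^ 2 * C.s * x + C.t) =
      C.u ^ 3 * (C • W).toAffine.negY x y + C.u ^ 2 * C.s * x + C.t := by
  have hu : (C.u : F) ≠ 0 := C.u.ne_zero
  simp only [Affine.negY, variableChange_def, Units.val_inv_eq_inv_val]
  field_simp
  ring

variable [DecidableEq F]

theorem variableChange_slope {x₁ x₂ y₁ y₂ : F} (h₁ : (C • W).toAffine.Equation x₁ y₁)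
    (h₂ : (C • W).toAffine.Equation x₂ y₂)
    (hxy : ¬(x₁ = x₂ ∧ y₁ = (C • W).toAffine.negY x₂ y₂)) :
    W.toAffine.slope (C.u ^ 2 * x₁ + C.r) (C.u ^ 2 * x₂ + C.r)
        (C.u ^ 3 * y₁ + C.u ^ 2 * C.s * x₁ + C.t) (C.u ^ 3 * y₂ + C.u ^ 2 * C.s * x₂ + C.t) =
      C.u * (C • W).toAffine.slope x₁ x₂ y₁ y₂ + C.s := by
  have hu : (C.u : F) ≠ 0 := C.u.ne_zero
  by_cases hx : x₁ = x₂
  · have hy : y₁ ≠ (C • W).toAffine.negY x₂ y₂ := fun h ↦ hxy ⟨hx, h⟩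
    have hy' : C.u ^ 3 * y₁ + C.u ^ 2 * C.s * x₁ + C.t ≠
        W.toAffine.negY (C.u ^ 2 * x₂ + C.r) (C.u ^ 3 * y₂ + C.u ^ 2 * C.s * x₂ + C.t) := by
      rw [variableChange_negY, hx]
      intro h
      apply hy
      simpa [hu] using h
    rw [Affine.slope_of_Y_ne hx hy, Affine.slope_of_Y_ne (by rw [hx]) hy', variableChange_negY]
    have hd : y₁ - (C • W).toAffine.negY x₁ y₁ ≠ 0 := by
      have := Affine.Y_eq_of_Y_ne h₁ h₂ hx hy
      rw [sub_ne_zero]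
      subst this hx
      exact hy
    have hd' : C.u ^ 3 * y₁ + C.u ^ 2 * C.s * x₁ + C.t -
        (C.u ^ 3 * (C • W).toAffine.negY x₁ y₁ + C.u ^ 2 * C.s * x₁ + C.t) =
          C.u ^ 3 * (y₁ - (C • W).toAffine.negY x₁ y₁) := by ring
    have hmul (N D : F) (hD : D ≠ 0) : C.u * (N / D) * (C.u ^ 3 * D) = C.u ^ 4 * N := by
      field_simp
    rw [hd', div_eq_iff (mul_ne_zero (pow_ne_zero _ hu) hd), add_mul, hmul _ _ hd]
    simp only [Affine.negY, variableChange_def, Units.val_inv_eq_inv_val]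
    field_simp
    ring
  · rw [Affine.slope_of_X_ne hx, Affine.slope_of_X_ne (by simpa [hu] using hx)]
    have hd : x₁ - x₂ ≠ 0 := sub_ne_zero.2 hx
    have hd' : C.u ^ 2 * x₁ + C.r - (C.u ^ 2 * x₂ + C.r) = C.u ^ 2 * (x₁ - x₂) := by ring
    rw [hd']
    field_simp
    ring

/-- The homomorphism on points induced by the change of variables
`(X, Y) ↦ (u²X + r, u³Y + u²sX + t)`. -/
noncomputable def Affine.Point.ofVariableChange [W.IsElliptic] :
    (C • W).toAffine.Point →+ W.toAffine.Point where
  toFun P := match P with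
    | 0 => 0
    | .some _ _ h => .mk (equation_of_variableChange C W h.1)
  map_zero' := rfl
  map_add' := by
    have hu : (C.u : F) ≠ 0 := C.u.ne_zero
    rintro (_ | ⟨x₁, y₁, h₁⟩) (_ | ⟨x₂, y₂, h₂⟩)
    any_goals rfl
    by_cases hxy : x₁ = x₂ ∧ y₁ = (C • W).toAffine.negY x₂ y₂
    · rw [Affine.Point.add_of_Y_eq hxy.1 hxy.2]
      refine (Affine.Point.add_of_Y_eq (by rw [hxy.1]) ?_).symm
      rw [variableChange_negY, hxy.1, hxy.2]
    · rw [Affine.Point.add_some hxy]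
      refine Eq.trans ?_ (Affine.Point.add_some ?_).symm
      · simp only [Affine.Point.mk, Affine.Point.some.injEq]
        rw [variableChange_slope C W h₁.1 h₂.1 hxy]
        generalize (C • W).toAffine.slope x₁ x₂ y₁ y₂ = l
        simp only [Affine.addX, Affine.addY, Affine.negAddY, Affine.negY, variableChange_def,
          Units.val_inv_eq_inv_val]
        constructor <;> field_simp <;> ring
      · rw [variableChange_negY]
        rintro ⟨hx, hy⟩
        have hx : x₁ = x₂ := by simpa [hu] using hx
        exact hxy ⟨hx, by simpa [hx, hu] using hy⟩

theorem Affine.Point.ofVariableChange_ne_zero [W.IsElliptic] {P : (C • W).toAffine.Point}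
    (hP : P ≠ 0) : ofVariableChange C W P ≠ 0 := by
  rcases P with _ | ⟨x, y, h⟩
  · exact (hP rfl).elim
  · exact Affine.Point.some_ne_zero _

theorem exists_torsion_of_variableChange [W.IsElliptic] {n : ℕ}
    (h : ∃ P : (C • W).toAffine.Point, P ≠ 0 ∧ n • P = 0) :
    ∃ P : W.toAffine.Point, P ≠ 0 ∧ n • P = 0 := by
  obtain ⟨P, hP, hn⟩ := h
  exact ⟨_, Affine.Point.ofVariableChange_ne_zero C W hP, by rw [← map_nsmul, hn, map_zero]⟩

theorem exists_torsion_variableChange [W.IsElliptic] {n : ℕ}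
    (h : ∃ P : W.toAffine.Point, P ≠ 0 ∧ n • P = 0) :
    ∃ P : (C • W).toAffine.Point, P ≠ 0 ∧ n • P = 0 := by
  refine exists_torsion_of_variableChange C⁻¹ (C • W) ?_
  rwa [inv_smul_smul]

end VariableChangePoints

/-! ### Short Weierstrass models -/

/-- The Weierstrass curve `Y² = X³ + aX + b`. -/
def shortCurve {R : Type*} [CommRing R] (a b : R) : WeierstrassCurve R := ⟨0, 0, 0, a, b⟩

/-- The free parameter `u` allows models over `ℚ` and over a residue field to be scaled compatibly.
-/
theorem exists_variableChange_eq_shortCurve {F : Type*} [Field F] (h2 : (2 : F) ≠ 0)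
    (h3 : (3 : F) ≠ 0) (W : WeierstrassCurve F) {u : F} (hu : u ≠ 0) :
    ∃ C : VariableChange F,
      C • W = shortCurve (-(u ^ 4 * W.c₄) / 48) (-(u ^ 6 * W.c₆) / 864) := by
  let : Invertible (2 : F) := invertibleOfNonzero h2
  let : Invertible (3 : F) := invertibleOfNonzero h3
  obtain ⟨C, hC⟩ := W.exists_variableChange_isShortNF
  have h48 : (48 : F) ≠ 0 := by
    rw [show (48 : F) = 2 ^ 4 * 3 by norm_num]; positivity
  have h864 : (864 : F) ≠ 0 := by
    rw [show (864 : F) = 2 ^ 5 * 3 ^ 3 by norm_num]; positivity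
  -- The scaling part of `C` is undone and replaced by `u⁻¹`, so that the coefficients depend only
  -- on `u` and the invariants of `W`.
  refine ⟨⟨C.u⁻¹ * (Units.mk0 u hu)⁻¹, 0, 0, 0⟩ * C, ?_⟩
  have h4 := (C • W).c₄_of_isShortNF
  have h6 := (C • W).c₆_of_isShortNF
  rw [variableChange_c₄, Units.val_inv_eq_inv_val] at h4
  rw [variableChange_c₆, Units.val_inv_eq_inv_val] at h6
  have hC0 : (C.u : F) ≠ 0 := C.u.ne_zero
  rw [mul_smul, variableChange_def]
  ext <;> simp only [shortCurve, (C • W).a₁_of_isShortNF, (C • W).a₂_of_isShortNF,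
    (C • W).a₃_of_isShortNF, mul_inv, inv_inv, Units.val_mul, Units.val_mk0]
  · simp
  · simp
  · simp
  · rw [eq_div_iff h48]
    field_simp at h4 ⊢
    linear_combination h4
  · rw [eq_div_iff h864]
    field_simp at h6 ⊢
    linear_combination h6

end WeierstrassCurve

/-! ### Cubics of constant quadratic character -/

open Polynomial in
-- Put `m = (p - 1) / 2` and `g = X² + cX + e`. The hypothesis determines `g ^ m` at the `2m`
-- nonzero points, hence as a polynomial: `g ^ m = X^(2m) + εX^m - 1`. Such a sparse `m`-th power
-- contradicts `g (g ^ m)' = m g' g ^ m` in degree `1`.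
theorem ZMod.not_forall_pow_half_eq {p : ℕ} [Fact p.Prime] (hp : 7 ≤ p) (c e : ZMod p) {ε : ZMod p}
    (hε : ∀ t : ZMod p, t ≠ 0 → (t * (t ^ 2 + c * t + e)) ^ (p / 2) = ε) : False := by
  have hodd : p % 2 = 1 := (Fact.out : p.Prime).eq_two_or_odd.resolve_left (by omega)
  -- Here `m = n + 3`; the bound `m ≥ 3`, that is `p ≥ 7`, puts `X^(m-1)` in degree at least `2`.
  obtain ⟨n, hn⟩ : ∃ n, p / 2 = n + 3 := ⟨p / 2 - 3, by omega⟩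
  have hpn : p = 2 * (n + 3) + 1 := by omega
  rw [hn] at hε
  set g : (ZMod p)[X] := X ^ 2 + C c * X + C e with hg
  have hgdeg : g.natDegree = 2 := by rw [hg]; compute_degree!
  have hgm : g.Monic := by rw [hg]; monicity!
  have hgdeg' : (g ^ (n + 3)).natDegree = 2 * (n + 3) := by
    rw [hgm.natDegree_pow, hgdeg, mul_comm]
  -- The difference has degree below `2m`, since the leading terms cancel, and vanishes at all `t ≠
  -- 0`, where `t^(2m) = 1`.
  have key : g ^ (n + 3) = X ^ (2 * (n + 3)) + C ε * X ^ (n + 3) - 1 := by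
    rw [← sub_eq_zero]
    have hdeg : (g ^ (n + 3) - (X ^ (2 * (n + 3)) + C ε * X ^ (n + 3) - 1)).natDegree <
        2 * (n + 3) := by
      have h1 : (g ^ (n + 3) - X ^ (2 * (n + 3))).degree < ((2 * (n + 3) : ℕ) : WithBot ℕ) := by
        have := degree_sub_lt_left (p := g ^ (n + 3)) (q := X ^ (2 * (n + 3)))
          (by rw [degree_eq_natDegree (hgm.pow _).ne_zero, degree_X_pow, hgdeg'])
          (hgm.pow _).ne_zero (by rw [(hgm.pow _).leadingCoeff, (monic_X_pow _).leadingCoeff])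
        rwa [degree_eq_natDegree (hgm.pow _).ne_zero, hgdeg'] at this
      have h2 : (C ε * X ^ (n + 3) - 1 : (ZMod p)[X]).degree < ((2 * (n + 3) : ℕ) : WithBot ℕ) := by
        refine (degree_sub_le _ _).trans_lt (max_lt ?_ ?_)
        · exact (degree_C_mul_X_pow_le _ _).trans_lt (by exact_mod_cast (by omega))
        · rw [degree_one]; exact_mod_cast (by omega)
      have h3 : (g ^ (n + 3) - (X ^ (2 * (n + 3)) + C ε * X ^ (n + 3) - 1)).degree <
          ((2 * (n + 3) : ℕ) : WithBot ℕ) := by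
        rw [show g ^ (n + 3) - (X ^ (2 * (n + 3)) + C ε * X ^ (n + 3) - 1) =
          (g ^ (n + 3) - X ^ (2 * (n + 3))) - (C ε * X ^ (n + 3) - 1) by ring]
        exact (degree_sub_le _ _).trans_lt (max_lt h1 h2)
      by_cases h0 : g ^ (n + 3) - (X ^ (2 * (n + 3)) + C ε * X ^ (n + 3) - 1) = 0
      · rw [h0, natDegree_zero]; omega
      · exact (natDegree_lt_iff_degree_lt h0).2 h3
    refine eq_zero_of_natDegree_lt_card_of_eval_eq_zero' _ (Finset.univ.erase (0 : ZMod p))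
      (fun t ht ↦ ?_) ?_
    · have ht0 : t ≠ 0 := (Finset.mem_erase.1 ht).1
      have hF : t ^ (2 * (n + 3)) = 1 := by
        have := ZMod.pow_card_sub_one_eq_one ht0
        rwa [show p - 1 = 2 * (n + 3) by omega] at this
      have := hε t ht0
      simp only [hg, eval_sub, eval_add, eval_pow, eval_mul, eval_C, eval_X, eval_one, hF]
      rw [mul_pow] at this
      have hF' : t ^ (n + 3) * t ^ (n + 3) = 1 := by rw [← pow_add, ← two_mul, hF]
      linear_combination t ^ (n + 3) * this - (t ^ 2 + c * t + e) ^ (n + 3) * hF'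
    · rw [Finset.card_erase_of_mem (Finset.mem_univ _), Finset.card_univ, ZMod.card]
      omega
  have hd : g * derivative (g ^ (n + 3)) =
      g * derivative (X ^ (2 * (n + 3)) + C ε * X ^ (n + 3) - 1) := by rw [key]
  have hL : g * derivative (g ^ (n + 3)) = C ((n + 3 : ℕ) : ZMod p) * derivative g *
      g ^ (n + 3) := by
    rw [derivative_pow]
    simp only [Nat.add_succ_sub_one]
    rw [pow_succ]
    ring
  have hg' : derivative g = C 2 * X + C c := by
    simp [hg, derivative_pow]
  rw [hL, key, hg'] at hd
  have hm : (2 : ZMod p) * ((n + 3 : ℕ) : ZMod p) = -1 := by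
    have : ((2 * (n + 3) + 1 : ℕ) : ZMod p) = 0 := by rw [← hpn]; simp
    push_cast at this ⊢
    linear_combination this
  -- The side with the derivative is divisible by `X²`; the other has `X`-coefficient `-2m = 1`.
  have hc := congrArg (fun q ↦ coeff q 1) hd
  have hR : g * derivative (X ^ (2 * (n + 3)) + C ε * X ^ (n + 3) - 1 : (ZMod p)[X]) =
      X ^ 2 * (g * (C ((2 * (n + 3) : ℕ) : ZMod p) * X ^ (2 * n + 3) +
        C ε * C ((n + 3 : ℕ) : ZMod p) * X ^ n)) := by
    simp only [derivative_sub, derivative_add, derivative_X_pow, derivative_C_mul, derivative_one]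
    rw [show 2 * (n + 3) - 1 = 2 * n + 3 + 2 by omega, show n + 3 - 1 = n + 2 by omega]
    ring
  have hL' : C ((n + 3 : ℕ) : ZMod p) * (C 2 * X + C c) *
      (X ^ (2 * (n + 3)) + C ε * X ^ (n + 3) - 1) =
      X ^ 2 * (C ((n + 3 : ℕ) : ZMod p) * (C 2 * X + C c) * (X ^ (2 * n + 4) + C ε * X ^ (n + 1))) -
      C (2 * ((n + 3 : ℕ) : ZMod p)) * X - C (((n + 3 : ℕ) : ZMod p) * c) := by
    simp only [C_mul]
    ring
  rw [hR, hL'] at hc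
  simp only [coeff_sub, coeff_X_pow_mul', hm] at hc
  simp at hc

/-! ### Equations for 2- and 3-torsion on short curves -/

namespace WeierstrassCurve

section ShortCurve

variable {R : Type*} [CommRing R]

theorem shortCurve_equation_iff (a b x y : R) :
    (shortCurve a b).toAffine.Equation x y ↔ y ^ 2 = x ^ 3 + a * x + b := by
  simp [Affine.equation_iff, shortCurve]

theorem shortCurve_negY (a b x y : R) : (shortCurve a b).toAffine.negY x y = -y := by
  simp [Affine.negY, shortCurve]

theorem shortCurve_Δ (a b : R) : (shortCurve a b).Δ = -16 * (4 * a ^ 3 + 27 * b ^ 2) := by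
  simp only [Δ, b₂, b₄, b₆, b₈, shortCurve]
  ring

variable {F : Type*} [Field F] [DecidableEq F]

theorem exists_of_shortCurve_two_torsion (h2 : (2 : F) ≠ 0) {a b : F}
    (h : ∃ P : (shortCurve a b).toAffine.Point, P ≠ 0 ∧ 2 • P = 0) :
    ∃ x : F, x ^ 3 + a * x + b = 0 := by
  obtain ⟨_ | ⟨x, y, h⟩, h0, hP⟩ := h
  · exact (h0 rfl).elim
  refine ⟨x, ?_⟩
  rw [two_nsmul, add_eq_zero_iff_eq_neg, Affine.Point.neg_some, Affine.Point.some.injEq,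
    shortCurve_negY] at hP
  have hy : y = 0 := by
    have : 2 * y = 0 := by linear_combination hP.2
    exact (mul_eq_zero.1 this).resolve_left h2
  rw [← (shortCurve_equation_iff a b x y).1 h.1, hy]
  ring

/-- The quartic is the third division polynomial; modulo the equation of the curve, its vanishing
says that `2P` and `P` have the same `x`-coordinate. -/
theorem shortCurve_three_nsmul_eq_zero (h2 : (2 : F) ≠ 0) {a b : F} {W : WeierstrassCurve F}
    (hW : W = shortCurve a b) [hE : W.IsElliptic] {x y : F} (h : W.toAffine.Nonsingular x y)
    (h3 : 3 * x ^ 4 + 6 * a * x ^ 2 + 12 * b * x - a ^ 2 = 0) :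
    3 • Affine.Point.some x y h = 0 := by
  subst hW
  have he := (shortCurve_equation_iff a b x y).1 h.1
  -- If `y = 0`, the quartic equals `-(3x² + a)²`, so `x` would be a double root of the cubic.
  have hy0 : y ≠ 0 := by
    rintro rfl
    have hΔ := hE.isUnit.ne_zero
    rw [shortCurve_Δ] at hΔ
    apply hΔ
    have h1 : (3 * x ^ 2 + a) ^ 2 = 0 := by linear_combination -h3 - 12 * x * he
    have h1 : 3 * x ^ 2 + a = 0 := by simpa using h1
    have ha : a = -3 * x ^ 2 := by linear_combination h1
    have hb : b = 2 * x ^ 3 := by linear_combination -he - x * ha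
    rw [ha, hb]
    ring
  have hy : y ≠ (shortCurve a b).toAffine.negY x y := by
    rw [shortCurve_negY]
    intro h
    have : 2 * y = 0 := by linear_combination h
    exact (mul_ne_zero h2 hy0) this
  have hX : (shortCurve a b).toAffine.addX x x ((shortCurve a b).toAffine.slope x x y y) = x := by
    rw [Affine.slope_of_Y_ne rfl hy, shortCurve_negY]
    simp only [Affine.addX, shortCurve, show y - -y = 2 * y by ring]
    field_simp
    linear_combination -h3 - 12 * x * he
  rw [succ_nsmul, two_nsmul, add_eq_zero_iff_eq_neg,
    Affine.Point.add_self_of_Y_ne' hy, neg_inj, Affine.Point.some.injEq]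
  refine ⟨hX, ?_⟩
  rw [Affine.negAddY, hX]
  ring

theorem exists_of_shortCurve_three_torsion {a b : F}
    (h : ∃ P : (shortCurve a b).toAffine.Point, P ≠ 0 ∧ 3 • P = 0) :
    ∃ x y : F, y ^ 2 = x ^ 3 + a * x + b ∧
        3 * x ^ 4 + 6 * a * x ^ 2 + 12 * b * x - a ^ 2 = 0 := by
  obtain ⟨_ | ⟨x, y, h⟩, h0, hP⟩ := h
  · exact (h0 rfl).elim
  have he := (shortCurve_equation_iff a b x y).1 h.1
  refine ⟨x, y, he, ?_⟩
  rw [succ_nsmul, two_nsmul, add_eq_zero_iff_eq_neg, Affine.Point.neg_some] at hP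
  by_cases hy : y = (shortCurve a b).toAffine.negY x y
  · rw [Affine.Point.add_self_of_Y_eq hy] at hP
    exact (Affine.Point.some_ne_zero _ hP.symm).elim
  · rw [Affine.Point.add_self_of_Y_ne hy, Affine.Point.some.injEq,
      Affine.slope_of_Y_ne rfl hy, shortCurve_negY] at hP
    rw [shortCurve_negY] at hy
    have hy0 : 2 * y ≠ 0 := fun h ↦ hy (by linear_combination h)
    have hx := hP.1
    simp only [Affine.addX, shortCurve, show y - -y = 2 * y by ring] at hx
    have h2 : (2 : F) ≠ 0 := left_ne_zero_of_mul hy0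
    have hy1 : y ≠ 0 := right_ne_zero_of_mul hy0
    field_simp at hx
    linear_combination -hx - 12 * x * he

end ShortCurve

end WeierstrassCurve

/-! ### Square roots on which Frobenius acts by a sign -/

section FrobeniusFibers

variable {p : ℕ} [Fact p.Prime] {k : Type*} [Field k] [Algebra (ZMod p) k] {φ : k →ₐ[ZMod p] k}

/-- The square roots of `c` in `k` which are eigenvectors of `φ` with eigenvalue `ε`. -/
def eigenSqrt (φ : k →ₐ[ZMod p] k) (ε : ℤ) (c : ZMod p) : Set k :=
  {y | φ y = ε * y ∧ y ^ 2 = algebraMap (ZMod p) k c}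

theorem eigenSqrt_subset_pair {ε : ℤ} {c : ZMod p} {y : k} (hy : y ^ 2 = algebraMap (ZMod p) k c) :
    eigenSqrt φ ε c ⊆ {y, -y} := by
  rintro z ⟨-, hz⟩
  exact sq_eq_sq_iff_eq_or_eq_neg.1 (hz.trans hy.symm)

theorem finite_eigenSqrt (φ : k →ₐ[ZMod p] k) (ε : ℤ) (c : ZMod p) : (eigenSqrt φ ε c).Finite := by
  rcases (eigenSqrt φ ε c).eq_empty_or_nonempty with h | ⟨y, hy⟩
  · simp [h]
  · exact (Set.toFinite {y, -y}).subset (eigenSqrt_subset_pair hy.2)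

theorem ncard_eigenSqrt_le_two (φ : k →ₐ[ZMod p] k) (ε : ℤ) (c : ZMod p) :
    (eigenSqrt φ ε c).ncard ≤ 2 := by
  rcases (eigenSqrt φ ε c).eq_empty_or_nonempty with h | ⟨y, hy⟩
  · simp [h]
  · exact (Set.ncard_le_ncard (eigenSqrt_subset_pair hy.2)).trans
      ((Set.ncard_insert_le _ _).trans (by rw [Set.ncard_singleton]))

theorem eigenSqrt_zero (φ : k →ₐ[ZMod p] k) (ε : ℤ) : eigenSqrt φ ε 0 = {0} := by
  ext y
  simp only [eigenSqrt, Set.mem_ofPred_eq, map_zero, Set.mem_singleton_iff]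
  constructor
  · rintro ⟨-, h⟩; simpa using h
  · rintro rfl; simp

/-- Two roots force `c ≠ 0`; then `c^((p-1)/2) = y^(p-1)`, which is the eigenvalue of `y`. -/
theorem pow_half_eq_of_one_lt_ncard_eigenSqrt (hp : p ≠ 2) (hφ : ∀ y, φ y = y ^ p) {ε : ℤ}
    {c : ZMod p} (h : 1 < (eigenSqrt φ ε c).ncard) : c ^ (p / 2) = ε := by
  obtain ⟨y, hy⟩ : (eigenSqrt φ ε c).Nonempty := Set.nonempty_of_ncard_ne_zero (by omega)
  have hy0 : y ≠ 0 := by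
    rintro rfl
    have hc : c = 0 := (map_eq_zero (algebraMap (ZMod p) k)).1 (by simpa using hy.2.symm)
    rw [hc, eigenSqrt_zero, Set.ncard_singleton] at h
    exact lt_irrefl _ h
  have hodd : p % 2 = 1 := (Fact.out : p.Prime).eq_two_or_odd.resolve_left hp
  apply (algebraMap (ZMod p) k).injective
  rw [map_pow, ← hy.2, map_intCast, ← pow_mul]
  have h1 := hy.1
  rw [hφ, show p = 2 * (p / 2) + 1 by omega, pow_succ] at h1
  exact mul_right_cancel₀ hy0 h1

/-- The square of `w` is a nonsquare of `𝔽_p`, so a nonsquare `c` becomes a square after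
multiplication by `w²`. -/
theorem exists_sq_eq_algebraMap (hp : p ≠ 2) {w : k} (hw0 : w ≠ 0) (hw : w ^ p = -w)
    (hφ : ∀ y, φ y = y ^ p) (hfix : ∀ y : k, φ y = y → ∃ c, algebraMap (ZMod p) k c = y)
    (c : ZMod p) : ∃ y : k, y ^ 2 = algebraMap (ZMod p) k c := by
  by_cases hc : IsSquare c
  · obtain ⟨s, rfl⟩ := hc
    exact ⟨algebraMap _ _ s, by rw [map_mul, sq]⟩
  have hw2 : φ (w ^ 2) = w ^ 2 := by rw [map_pow, hφ, hw, neg_sq]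
  obtain ⟨e, he⟩ := hfix _ hw2
  have he0 : e ≠ 0 := by
    rintro rfl
    rw [map_zero] at he
    exact hw0 (by simpa using he.symm)
  have he' : ¬ IsSquare e := by
    rintro ⟨s, rfl⟩
    rw [map_mul, ← sq] at he
    have hs : φ w = w := by
      rcases sq_eq_sq_iff_eq_or_eq_neg.1 he.symm with h | h
      · rw [h, φ.commutes]
      · rw [h, map_neg, φ.commutes]
    rw [hφ, hw] at hs
    have h2 : (2 : k) * w = 0 := by linear_combination -hs
    rcases mul_eq_zero.1 h2 with h2 | h2
    · have : (2 : ZMod p) = 0 := (map_eq_zero (algebraMap (ZMod p) k)).1 (by rwa [map_ofNat])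
      have := (ZMod.natCast_eq_zero_iff 2 p).1 (by exact_mod_cast this)
      exact hp ((Nat.prime_dvd_prime_iff_eq Fact.out Nat.prime_two).1 this)
    · exact hw0 h2
  have hc0 : c ≠ 0 := by rintro rfl; exact hc (IsSquare.zero)
  have hce : IsSquare (c * e) := by
    rw [← quadraticChar_one_iff_isSquare (mul_ne_zero hc0 he0), map_mul,
      quadraticChar_neg_one_iff_not_isSquare.2 hc, quadraticChar_neg_one_iff_not_isSquare.2 he']
    norm_num
  obtain ⟨s, hs⟩ := hce
  refine ⟨algebraMap _ _ s / w, ?_⟩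
  rw [div_pow, div_eq_iff (pow_ne_zero _ hw0), ← he, ← map_pow, ← map_mul, hs, sq]

/-- For `c ≠ 0` both roots have the same sign; for `c = 0` the root `0` counts once for each sign.
-/
theorem ncard_eigenSqrt_add (h2 : (2 : k) ≠ 0) {c : ZMod p}
    (hc : ∃ y : k, y ^ 2 = algebraMap (ZMod p) k c) :
    (eigenSqrt φ 1 c).ncard + (eigenSqrt φ (-1) c).ncard = 2 := by
  obtain ⟨y, hy⟩ := hc
  by_cases hc0 : c = 0
  · rw [hc0, eigenSqrt_zero, eigenSqrt_zero, Set.ncard_singleton]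
  have hy0 : y ≠ 0 := by
    rintro rfl
    exact hc0 ((map_eq_zero (algebraMap (ZMod p) k)).1 (by simpa using hy.symm))
  have hyne : y ≠ -y := by
    intro h
    exact mul_ne_zero h2 hy0 (by linear_combination h)
  have hsq : φ y = y ∨ φ y = -y := by
    apply sq_eq_sq_iff_eq_or_eq_neg.1
    rw [← map_pow, hy, φ.commutes]
  have hmem (ε : ℤ) (h : φ y = ε * y) : (eigenSqrt φ ε c).ncard = 2 := by
    rw [← Set.ncard_pair hyne]
    congr 1
    refine (eigenSqrt_subset_pair hy).antisymm ?_
    rintro z (rfl | rfl)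
    · exact ⟨h, hy⟩
    · exact ⟨by rw [map_neg, h]; ring, by rw [neg_sq, hy]⟩
  have hempty (ε : ℤ) (h : φ y ≠ ε * y) : (eigenSqrt φ ε c).ncard = 0 := by
    rw [Set.ncard_eq_zero (finite_eigenSqrt _ _ _), Set.eq_empty_iff_forall_notMem]
    intro z hz
    rcases eigenSqrt_subset_pair hy hz with rfl | rfl
    · exact h hz.1
    · apply h
      have := hz.1
      rw [map_neg] at this
      linear_combination -this
  rcases hsq with h | h
  · rw [hmem 1 (by simp [h]), hempty (-1) (by simpa [h] using hyne)]
  · rw [hmem (-1) (by simp [h]), hempty 1 (by simpa [h] using hyne.symm)]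

end FrobeniusFibers

/-! ### Points over `𝔽_p` and on the twist, as Frobenius eigenpoints -/

namespace WeierstrassCurve

section Eigenpoints

variable {p : ℕ} [Fact p.Prime] {k : Type*} [Field k] [Algebra (ZMod p) k]
  (φ : k →ₐ[ZMod p] k) (a b : ZMod p)

theorem baseChange_shortCurve_equation_iff (x y : k) :
    ((shortCurve a b).baseChange k).toAffine.Equation x y ↔
      y ^ 2 = x ^ 3 + algebraMap _ k a * x + algebraMap _ k b := by
  rw [← shortCurve_equation_iff]
  simp [Affine.equation_iff, shortCurve, baseChange]

theorem baseChange_shortCurve_negY (x y : k) :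
    ((shortCurve a b).baseChange k).toAffine.negY x y = -y := by
  simp [Affine.negY, shortCurve, baseChange]

variable [DecidableEq k]

/-- The points `P` with `φ P = ε P`. -/
noncomputable def eigenpoints (ε : ℤ) :
    AddSubgroup ((shortCurve a b).baseChange k).toAffine.Point :=
  (Affine.Point.map (W' := shortCurve a b) φ - ε • AddMonoidHom.id _).ker

variable {φ a b}

theorem mem_eigenpoints {ε : ℤ} {P : ((shortCurve a b).baseChange k).toAffine.Point} :
    P ∈ eigenpoints φ a b ε ↔ Affine.Point.map (W' := shortCurve a b) φ P = ε • P := by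
  rw [eigenpoints, AddMonoidHom.mem_ker, AddMonoidHom.sub_apply, sub_eq_zero]
  rfl

theorem some_mem_eigenpoints {ε : ℤ} (hε : ε = 1 ∨ ε = -1) {x y : k}
    (h : ((shortCurve a b).baseChange k).toAffine.Nonsingular x y) :
    Affine.Point.some x y h ∈ eigenpoints φ a b ε ↔ φ x = x ∧ φ y = ε * y := by
  rw [mem_eigenpoints, Affine.Point.map_some]
  rcases hε with rfl | rfl
  · simp
  · rw [neg_one_smul, Affine.Point.neg_some, Affine.Point.some.injEq, baseChange_shortCurve_negY]
    simp

/-- An eigenpoint for `±1` has `x` fixed by `φ`, hence in `𝔽_p`; the count is fibre by fibre over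
`x`, plus the point at infinity. -/
theorem natCard_eigenpoints [((shortCurve a b).baseChange k).IsElliptic]
    (hfix : ∀ y : k, φ y = y → ∃ c, algebraMap (ZMod p) k c = y)
    {ε : ℤ} (hε : ε = 1 ∨ ε = -1) :
    Finite (eigenpoints φ a b ε) ∧ Nat.card (eigenpoints φ a b ε) =
      ∑ x : ZMod p, (eigenSqrt φ ε (x ^ 3 + a * x + b)).ncard + 1 := by
  let f : Option (Σ x : ZMod p, eigenSqrt φ ε (x ^ 3 + a * x + b)) → eigenpoints φ a b ε
    | none => 0
    | some ⟨x, y, hy⟩ => ⟨.mk (x := algebraMap (ZMod p) k x) (y := y)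
        ((baseChange_shortCurve_equation_iff a b _ y).2 (by simpa using hy.2)),
        (some_mem_eigenpoints hε _).2 ⟨φ.commutes x, hy.1⟩⟩
  have hf : Function.Bijective f := by
    constructor
    · rintro (_ | ⟨x, y, hy⟩) (_ | ⟨x', y', hy'⟩) h
      · rfl
      · exact (Affine.Point.some_ne_zero _ (congrArg Subtype.val h).symm).elim
      · exact (Affine.Point.some_ne_zero _ (congrArg Subtype.val h)).elim
      · have h := congrArg Subtype.val h
        simp only [f, Affine.Point.mk, Affine.Point.some.injEq] at h
        obtain rfl := (algebraMap (ZMod p) k).injective h.1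
        obtain rfl := h.2
        rfl
    · rintro ⟨_ | ⟨x, y, h⟩, hP⟩
      · exact ⟨none, rfl⟩
      · obtain ⟨hx, hy⟩ := (some_mem_eigenpoints hε h).1 hP
        obtain ⟨c, rfl⟩ := hfix x hx
        refine ⟨some ⟨c, y, hy, ?_⟩, rfl⟩
        rw [(baseChange_shortCurve_equation_iff a b _ y).1 h.1]
        simp
  have hfin (x : ZMod p) : Finite (eigenSqrt φ ε (x ^ 3 + a * x + b)) :=
    (finite_eigenSqrt _ _ _).to_subtype
  refine ⟨Finite.of_surjective f hf.2, ?_⟩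
  rw [← Nat.card_congr (Equiv.ofBijective f hf), Finite.card_option, Nat.card_sigma]
  simp only [Nat.card_coe_set_eq]

/-- As `φ` is an involution, `P + φP` is fixed; if it is zero, `P` itself has sign `-1`. -/
theorem exists_eigenpoint_of_torsion (hφ : ∀ y : k, φ (φ y) = y)
    (h : ∃ P : ((shortCurve a b).baseChange k).toAffine.Point, P ≠ 0 ∧ p • P = 0) :
    ∃ ε : ℤ, (ε = 1 ∨ ε = -1) ∧ ∃ P ∈ eigenpoints φ a b ε, P ≠ 0 ∧ p • P = 0 := by
  obtain ⟨P, hP, hpP⟩ := h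
  have hφφ : Affine.Point.map (W' := shortCurve a b) φ
      (Affine.Point.map (W' := shortCurve a b) φ P) = P := by
    rcases P with _ | ⟨x, y, hxy⟩
    · rfl
    · simp [Affine.Point.map_some, hφ]
  by_cases h : P + Affine.Point.map (W' := shortCurve a b) φ P = 0
  · refine ⟨-1, .inr rfl, P, ?_, hP, hpP⟩
    rw [mem_eigenpoints, neg_one_smul]
    exact eq_neg_of_add_eq_zero_right h
  · refine ⟨1, .inl rfl, _, ?_, h, ?_⟩
    · rw [mem_eigenpoints, one_smul, map_add, hφφ, add_comm]
    · rw [smul_add, ← map_nsmul, hpP, map_zero, add_zero]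

theorem dvd_natCard_eigenpoints {q : ℕ} (hq : q.Prime) {ε : ℤ}
    {P : ((shortCurve a b).baseChange k).toAffine.Point} (hmem : P ∈ eigenpoints φ a b ε)
    (hP : P ≠ 0) (hqP : q • P = 0) : q ∣ Nat.card (eigenpoints φ a b ε) := by
  have : Fact q.Prime := ⟨hq⟩
  have h := addOrderOf_dvd_natCard (⟨P, hmem⟩ : eigenpoints φ a b ε)
  rwa [addOrderOf_eq_prime (p := q) (Subtype.ext hqP) (fun h ↦ hP (congrArg Subtype.val h))] at h

end Eigenpoints

end WeierstrassCurve

/-! ### Absence of `p`-torsion over the residue field -/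

namespace WeierstrassCurve

section FiniteField

variable {p : ℕ} [Fact p.Prime] {k : Type*} [Field k] [Algebra (ZMod p) k]

theorem baseChange_shortCurve (a b : ZMod p) :
    (shortCurve a b).baseChange k = shortCurve (algebraMap _ k a) (algebraMap _ k b) := by
  ext <;> simp [shortCurve, baseChange]

theorem exists_algebraMap_eq_of_pow_eq_self {y : k} (h : y ^ p = y) :
    ∃ c, algebraMap (ZMod p) k c = y := by
  have : CharP k p := charP_of_injective_algebraMap (algebraMap (ZMod p) k).injective p
  have h := (Subfield.mem_bot_iff_pow_eq_self (F := k) p).2 h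
  rw [Subfield.bot_eq_of_zMod_algebra p] at h
  exact h

theorem ofNat_ne_zero_of_zmod_algebra {n : ℕ} (h0 : 0 < n) (hn : n < p) : (n : k) ≠ 0 := by
  have : CharP k p := charP_of_injective_algebraMap (algebraMap (ZMod p) k).injective p
  rw [Ne, CharP.cast_eq_zero_iff k p]
  exact Nat.not_dvd_of_pos_of_lt h0 hn

variable [DecidableEq k] {a b : ZMod p} 
  [((shortCurve a b).baseChange k).IsElliptic]

theorem not_exists_torsion_of_two_torsion (hp : 7 ≤ p) (hk : ∀ z : k, z ^ p ^ 2 = z)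
    {x₀ : ZMod p} (hx₀ : x₀ ^ 3 + a * x₀ + b = 0) :
    ¬ ∃ P : ((shortCurve a b).baseChange k).toAffine.Point, P ≠ 0 ∧ p • P = 0 := by
  intro h
  have hpp : p.Prime := Fact.out
  set φ := FiniteField.frobeniusAlgHom (ZMod p) k
  have hφ (y : k) : φ y = y ^ p := by simp [φ, ZMod.card]
  have hfix (y : k) (hy : φ y = y) : ∃ c, algebraMap (ZMod p) k c = y :=
    exists_algebraMap_eq_of_pow_eq_self (by rwa [hφ] at hy)
  obtain ⟨ε, hε, P, hmem, hP, hpP⟩ := exists_eigenpoint_of_torsion (φ := φ)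
    (fun y ↦ by rw [hφ, hφ, ← pow_mul, ← sq, hk]) h
  obtain ⟨hfin, hcard⟩ := natCard_eigenpoints (φ := φ) (a := a) (b := b) hfix hε
  have heq : ((shortCurve a b).baseChange k).toAffine.Equation (algebraMap _ k x₀) 0 := by
    rw [baseChange_shortCurve_equation_iff, ← map_pow, ← map_mul, ← map_add, ← map_add, hx₀]
    simp
  have h2 : 2 ∣ Nat.card (eigenpoints φ a b ε) := by
    refine dvd_natCard_eigenpoints Nat.prime_two (P := .mk heq)
      ((some_mem_eigenpoints hε _).2 ⟨φ.commutes x₀, by simp⟩) (Affine.Point.some_ne_zero _) ?_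
    rw [two_nsmul, Affine.Point.mk]
    exact Affine.Point.add_self_of_Y_eq (by rw [baseChange_shortCurve_negY, neg_zero])
  have h2p : 2 * p ∣ Nat.card (eigenpoints φ a b ε) :=
    Nat.Coprime.mul_dvd_of_dvd_of_dvd
      ((Nat.coprime_primes Nat.prime_two hpp).2 (by omega)) h2
      (dvd_natCard_eigenpoints hpp hmem hP hpP)
  have hle := Nat.le_of_dvd Nat.card_pos h2p
  refine ZMod.not_forall_pow_half_eq hp (3 * x₀) (3 * x₀ ^ 2 + a) (ε := ε) fun t ht ↦ ?_
  rw [show t * (t ^ 2 + 3 * x₀ * t + (3 * x₀ ^ 2 + a)) =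
    (x₀ + t) ^ 3 + a * (x₀ + t) + b by linear_combination -hx₀]
  refine pow_half_eq_of_one_lt_ncard_eigenSqrt (φ := φ) (by omega) hφ ?_
  -- If `x₀ + t` carried at most one point, the order would be at most `1 + 1 + 2(p - 2) + 1 = 2p -
  -- 1`.
  by_contra! hlt
  have hne : x₀ + t ≠ x₀ := by simpa using ht
  rw [hcard, ← Finset.add_sum_erase _ _ (Finset.mem_univ x₀), hx₀, eigenSqrt_zero,
    Set.ncard_singleton, ← Finset.add_sum_erase _ _
      (Finset.mem_erase.2 ⟨hne, Finset.mem_univ (x₀ + t)⟩)] at hle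
  have hsum := Finset.sum_le_card_nsmul ((Finset.univ.erase x₀).erase (x₀ + t))
    (fun x ↦ (eigenSqrt φ ε (x ^ 3 + a * x + b)).ncard) 2
    (fun x _ ↦ ncard_eigenSqrt_le_two _ _ _)
  rw [Finset.card_erase_of_mem (Finset.mem_erase.2 ⟨hne, Finset.mem_univ (x₀ + t)⟩),
    Finset.card_erase_of_mem (Finset.mem_univ _), Finset.card_univ, ZMod.card, smul_eq_mul] at hsum
  omega

theorem not_exists_torsion_of_three_torsion (hp : 7 ≤ p) (hk : ∀ z : k, z ^ p ^ 2 = z)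
    (hk1 : p % 3 = 1 → ∀ z : k, z ^ p = z) {x₀ y₀ : ZMod p} (h₀ : y₀ ^ 2 = x₀ ^ 3 + a * x₀ + b)
    (h3 : 3 * x₀ ^ 4 + 6 * a * x₀ ^ 2 + 12 * b * x₀ - a ^ 2 = 0) :
    ¬ ∃ P : ((shortCurve a b).baseChange k).toAffine.Point, P ≠ 0 ∧ p • P = 0 := by
  intro h
  have hpp : p.Prime := Fact.out
  set φ := FiniteField.frobeniusAlgHom (ZMod p) k
  have hφ (y : k) : φ y = y ^ p := by simp [φ, ZMod.card]
  have hfix (y : k) (hy : φ y = y) : ∃ c, algebraMap (ZMod p) k c = y :=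
    exists_algebraMap_eq_of_pow_eq_self (by rwa [hφ] at hy)
  have h2 : (2 : k) ≠ 0 := by
    exact_mod_cast ofNat_ne_zero_of_zmod_algebra (k := k) (p := p) two_pos (by omega)
  have hcard (ε : ℤ) (hε : ε = 1 ∨ ε = -1) :=
    natCard_eigenpoints (φ := φ) (a := a) (b := b) hfix hε
  have hbound (ε : ℤ) (hε : ε = 1 ∨ ε = -1) : Nat.card (eigenpoints φ a b ε) < 3 * p := by
    have hsum := Finset.sum_le_card_nsmul Finset.univ
      (fun x ↦ (eigenSqrt φ ε (x ^ 3 + a * x + b)).ncard) 2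
      (fun x _ ↦ ncard_eigenSqrt_le_two _ _ _)
    rw [Finset.card_univ, ZMod.card, smul_eq_mul] at hsum
    rw [(hcard ε hε).2]
    omega
  have hplus : 3 ∣ Nat.card (eigenpoints φ a b 1) := by
    have heq : ((shortCurve a b).baseChange k).toAffine.Equation
        (algebraMap _ k x₀) (algebraMap _ k y₀) := by
      rw [baseChange_shortCurve_equation_iff, ← map_pow, h₀]
      simp
    refine dvd_natCard_eigenpoints Nat.prime_three (P := .mk heq)
      ((some_mem_eigenpoints (.inl rfl) _).2 ⟨φ.commutes x₀, by simp⟩)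
      (Affine.Point.some_ne_zero _) ?_
    refine shortCurve_three_nsmul_eq_zero h2 (baseChange_shortCurve a b) _ ?_
    have := congrArg (algebraMap (ZMod p) k) h3
    simpa only [map_sub, map_add, map_mul, map_pow, map_ofNat, map_zero] using this
  have hcontra (ε : ℤ) (hε : ε = 1 ∨ ε = -1) (h3 : 3 ∣ Nat.card (eigenpoints φ a b ε))
      (hpd : p ∣ Nat.card (eigenpoints φ a b ε)) : False := by
    have := (hcard ε hε).1
    have h3p := Nat.Coprime.mul_dvd_of_dvd_of_dvd
      ((Nat.coprime_primes Nat.prime_three hpp).2 (by omega)) h3 hpd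
    exact absurd (Nat.le_of_dvd Nat.card_pos h3p) (not_le.2 (hbound ε hε))
  by_cases hid : ∀ z : k, z ^ p = z
  · obtain ⟨P, hP, hpP⟩ := h
    refine hcontra 1 (.inl rfl) hplus (dvd_natCard_eigenpoints hpp (P := P) ?_ hP hpP)
    rcases P with _ | ⟨x, y, hxy⟩
    · exact zero_mem _
    · exact (some_mem_eigenpoints (.inl rfl) _).2 ⟨by rw [hφ, hid], by rw [hφ, hid]; simp⟩
  · have hp3 : p % 3 = 2 := by
      have h1 : p % 3 ≠ 1 := fun h ↦ hid (hk1 h)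
      have h0 : p % 3 ≠ 0 := fun h ↦ by
        have := (Nat.prime_dvd_prime_iff_eq Nat.prime_three hpp).1 (Nat.dvd_of_mod_eq_zero h)
        omega
      omega
    push Not at hid
    obtain ⟨z, hz⟩ := hid
    -- An element of sign `-1`, so every element of `𝔽_p` is a square in `k`.
    have hw : (z - z ^ p) ^ p = -(z - z ^ p) := by
      rw [← hφ, map_sub, hφ, hφ, ← pow_mul, ← sq, hk]
      ring
    have hw0 : z - z ^ p ≠ 0 := sub_ne_zero.2 hz.symm
    have hsum : Nat.card (eigenpoints φ a b 1) + Nat.card (eigenpoints φ a b (-1)) =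
        2 * p + 2 := by
      rw [(hcard 1 (.inl rfl)).2, (hcard (-1) (.inr rfl)).2]
      have : ∑ x : ZMod p, ((eigenSqrt φ 1 (x ^ 3 + a * x + b)).ncard +
          (eigenSqrt φ (-1) (x ^ 3 + a * x + b)).ncard) = 2 * p := by
        rw [Finset.sum_congr rfl fun x _ ↦ ncard_eigenSqrt_add h2
          (exists_sq_eq_algebraMap (by omega) hw0 hw hφ hfix _)]
        simp [ZMod.card, mul_comm]
      rw [Finset.sum_add_distrib] at this
      omega
    obtain ⟨ε, hε, P, hmem, hP, hpP⟩ := exists_eigenpoint_of_torsion (φ := φ)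
      (fun y ↦ by rw [hφ, hφ, ← pow_mul, ← sq, hk]) h
    refine hcontra ε hε ?_ (dvd_natCard_eigenpoints hpp hmem hP hpP)
    rcases hε with rfl | rfl
    · exact hplus
    -- `3` divides `2p + 2` because `p ≡ 2 mod 3`, and it divides the order for `ε = 1`.
    · omega

end FiniteField

end WeierstrassCurve

/-! ### Reduction of elements to the residue field -/

namespace ValuationSubring

variable {L : Type*} [Field L] {A : ValuationSubring L}

/-- The element `x` of `L` is integral and its residue class is `z`. -/
def ReducesTo (A : ValuationSubring L) (x : L) (z : IsLocalRing.ResidueField A) : Prop :=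
  ∃ h : x ∈ A, IsLocalRing.residue A ⟨x, h⟩ = z

namespace ReducesTo

variable {x y : L} {z w : IsLocalRing.ResidueField A}

theorem add (hx : A.ReducesTo x z) (hy : A.ReducesTo y w) : A.ReducesTo (x + y) (z + w) := by
  obtain ⟨h, rfl⟩ := hx
  obtain ⟨h', rfl⟩ := hy
  exact ⟨A.add_mem _ _ h h', map_add (IsLocalRing.residue A) ⟨x, h⟩ ⟨y, h'⟩⟩

theorem mul (hx : A.ReducesTo x z) (hy : A.ReducesTo y w) : A.ReducesTo (x * y) (z * w) := by
  obtain ⟨h, rfl⟩ := hx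
  obtain ⟨h', rfl⟩ := hy
  exact ⟨A.mul_mem _ _ h h', map_mul (IsLocalRing.residue A) ⟨x, h⟩ ⟨y, h'⟩⟩

theorem neg (hx : A.ReducesTo x z) : A.ReducesTo (-x) (-z) := by
  obtain ⟨h, rfl⟩ := hx
  exact ⟨A.neg_mem _ h, map_neg (IsLocalRing.residue A) ⟨x, h⟩⟩

theorem sub (hx : A.ReducesTo x z) (hy : A.ReducesTo y w) : A.ReducesTo (x - y) (z - w) := by
  rw [sub_eq_add_neg, sub_eq_add_neg]
  exact hx.add hy.neg

theorem pow (hx : A.ReducesTo x z) (n : ℕ) : A.ReducesTo (x ^ n) (z ^ n) := by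
  obtain ⟨h, rfl⟩ := hx
  exact ⟨pow_mem h n, map_pow (IsLocalRing.residue A) ⟨x, h⟩ n⟩

theorem intCast (n : ℤ) : A.ReducesTo (n : L) (n : IsLocalRing.ResidueField A) :=
  ⟨intCast_mem A n, map_intCast _ n⟩

theorem natCast (n : ℕ) : A.ReducesTo (n : L) (n : IsLocalRing.ResidueField A) :=
  ⟨natCast_mem A n, map_natCast _ n⟩

theorem ofNat (n : ℕ) [n.AtLeastTwo] :
    A.ReducesTo (OfNat.ofNat n : L) (OfNat.ofNat n : IsLocalRing.ResidueField A) := by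
  have := natCast (A := A) (OfNat.ofNat n)
  rwa [Nat.cast_ofNat, Nat.cast_ofNat] at this

theorem unique (hx : A.ReducesTo x z) (hx' : A.ReducesTo x w) : z = w := by
  obtain ⟨h, rfl⟩ := hx
  obtain ⟨h', rfl⟩ := hx'
  rfl

theorem inv (hx : A.ReducesTo x z) (hz : z ≠ 0) : A.ReducesTo x⁻¹ z⁻¹ := by
  obtain ⟨h, rfl⟩ := hx
  have hu : IsUnit (⟨x, h⟩ : A) := by
    rwa [IsLocalRing.residue_ne_zero_iff_isUnit] at hz
  obtain ⟨w, hw⟩ := isUnit_iff_exists_inv.1 hu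
  have hw' : x * w = 1 := congrArg Subtype.val hw
  rw [← eq_inv_of_mul_eq_one_right hw', ← eq_inv_of_mul_eq_one_right
    (show IsLocalRing.residue A ⟨x, h⟩ * IsLocalRing.residue A w = 1 by
      rw [← map_mul, hw, map_one])]
  exact ⟨w.2, rfl⟩

end ReducesTo

section RationalNumbers

open WithZero

variable {V : Valuation L ℤᵐ⁰} (hA : ∀ x, x ∈ A ↔ V x ≤ 1)

include hA in
theorem reducesTo_zero_iff {x : L} : A.ReducesTo x 0 ↔ V x < 1 := by
  constructor
  · rintro ⟨h, h0⟩
    refine lt_of_le_of_ne ((hA x).1 h) fun h1 ↦ ?_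
    rw [IsLocalRing.residue_eq_zero_iff, IsLocalRing.mem_maximalIdeal, _root_.mem_nonunits_iff] at h0
    have hx : x ≠ 0 := by rintro rfl; simp at h1
    refine h0 (isUnit_iff_exists_inv.2 ⟨⟨x⁻¹, (hA _).2 (by rw [map_inv₀, h1, inv_one])⟩, ?_⟩)
    exact Subtype.ext (mul_inv_cancel₀ hx)
  · intro h
    refine ⟨(hA x).2 h.le, ?_⟩
    rw [IsLocalRing.residue_eq_zero_iff, IsLocalRing.mem_maximalIdeal, _root_.mem_nonunits_iff]
    intro hu
    obtain ⟨w, hw⟩ := isUnit_iff_exists_inv.1 hu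
    have hw' : V x * V w = 1 := by rw [← map_mul, ← map_one V]; exact congrArg V (congrArg Subtype.val hw)
    exact (mul_lt_one_of_lt_of_le h ((hA _).1 w.2)).ne hw'

include hA in
theorem exists_reducesTo {x : L} (hx : V x ≤ 1) : ∃ z, A.ReducesTo x z :=
  ⟨_, (hA x).2 hx, rfl⟩

include hA in
theorem ReducesTo.valuation_le_one {x : L} {z : IsLocalRing.ResidueField A}
    (h : A.ReducesTo x z) : V x ≤ 1 := (hA x).1 h.1

include hA in
theorem ReducesTo.valuation_eq_one {x : L} {z : IsLocalRing.ResidueField A}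
    (h : A.ReducesTo x z) (hz : z ≠ 0) : V x = 1 :=
  (h.valuation_le_one hA).antisymm <| not_lt.1 fun h1 ↦
    hz (h.unique ((reducesTo_zero_iff hA).2 h1))

include hA in
theorem ReducesTo.ne_zero {x : L} {z : IsLocalRing.ResidueField A}
    (h : A.ReducesTo x z) (hx : V x = 1) : z ≠ 0 := by
  rintro rfl
  exact ((reducesTo_zero_iff hA).1 h).ne hx

variable {p : ℕ} [Fact p.Prime] [Algebra (ZMod p) (IsLocalRing.ResidueField A)]

theorem intCast_residueField_eq_zero_iff {n : ℤ} :
    (n : IsLocalRing.ResidueField A) = 0 ↔ (p : ℤ) ∣ n := by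
  rw [← map_intCast (algebraMap (ZMod p) (IsLocalRing.ResidueField A)), map_eq_zero, ZMod.intCast_zmod_eq_zero_iff_dvd]

include hA in
theorem valuation_intCast_eq_one_iff {n : ℤ} : V n = 1 ↔ ¬ (p : ℤ) ∣ n := by
  rw [← intCast_residueField_eq_zero_iff (A := A)]
  refine ⟨fun h ↦ (ReducesTo.intCast n).ne_zero hA h,
    fun h ↦ (ReducesTo.intCast n).valuation_eq_one hA h⟩

include hA in
theorem valuation_ratCast_eq_zpow [CharZero L] {q : ℚ} (hq : q ≠ 0) :
    ∃ j : ℤ, V q = V p ^ j := by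
  have hnat (n : ℕ) (hn : n ≠ 0) : ∃ i : ℕ, V n = V p ^ i := by
    obtain ⟨i, m, hm, rfl⟩ := Nat.exists_eq_pow_mul_and_not_dvd hn p (Fact.out : p.Prime).ne_one
    refine ⟨i, ?_⟩
    have h1 : V ((m : ℤ) : L) = 1 := (valuation_intCast_eq_one_iff hA (p := p)).2 (by exact_mod_cast hm)
    rw [Int.cast_natCast] at h1
    rw [Nat.cast_mul, map_mul, h1, mul_one, Nat.cast_pow, map_pow]
  obtain ⟨i, hi⟩ := hnat q.num.natAbs (by simpa using hq)
  obtain ⟨i', hi'⟩ := hnat q.den q.den_ne_zero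
  have hp0 : V p ≠ 0 := by
    rw [Ne, map_eq_zero]
    exact_mod_cast (Fact.out : p.Prime).ne_zero
  have hi : V q.num = V p ^ i := by
    rw [← hi]
    rcases Int.natAbs_eq q.num with h | h
    · conv_lhs => rw [h]
      simp
    · conv_lhs => rw [h]
      simp [Valuation.map_neg]
  refine ⟨i - i', ?_⟩
  rw [Rat.cast_def, map_div₀, hi, hi', zpow_sub₀ hp0, zpow_natCast, zpow_natCast]

include hA in
-- In lowest terms, `p` cannot divide the denominator of an integral `q`: the numerator would then
-- be a unit.
theorem exists_reducesTo_ratCast [CharZero L] {q : ℚ} (hq : V q ≤ 1) :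
    ∃ c : ZMod p, A.ReducesTo q (algebraMap _ _ c) := by
  have hden : ((q.den : ℤ) : IsLocalRing.ResidueField A) ≠ 0 := by
    rw [Ne, intCast_residueField_eq_zero_iff (p := p)]
    intro hd
    have hn : V q.num = 1 := (valuation_intCast_eq_one_iff hA (p := p)).2 fun hn ↦ by
      have h1 := Nat.dvd_gcd (Int.natCast_dvd.1 hn) (Int.natCast_dvd_natCast.1 hd)
      rw [q.reduced] at h1
      exact (Fact.out : p.Prime).one_lt.not_ge (Nat.le_of_dvd one_pos h1)
    have hd' : V q.den < 1 := by
      rw [← reducesTo_zero_iff hA]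
      have := ReducesTo.intCast (A := A) (q.den : ℤ)
      rw [intCast_residueField_eq_zero_iff (p := p) |>.2 hd, Int.cast_natCast] at this
      exact this
    have hmul : V q * V q.den = 1 := by
      rw [← map_mul, ← hn]
      congr 1
      exact_mod_cast Rat.mul_den_eq_num q
    exact (mul_lt_one_of_nonneg_of_lt_one_right hq zero_le hd').ne hmul
  refine ⟨q.num / (q.den : ℤ), ?_⟩
  have h := (ReducesTo.intCast q.num).mul ((ReducesTo.intCast (q.den : ℤ)).inv hden)
  rw [map_div₀, map_intCast, map_intCast, div_eq_mul_inv, Rat.cast_def, div_eq_mul_inv]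
  rwa [Int.cast_natCast (R := L)] at h

end RationalNumbers

end ValuationSubring

/-! ### Value group and residue field when `p ∤ 2d` -/

namespace ValuationSubring

open WithZero

variable {L : Type*} [Field L] [CharZero L] {V : Valuation L ℤᵐ⁰} {A : ValuationSubring L}
  (hA : ∀ x, x ∈ A ↔ V x ≤ 1) {p : ℕ} [Fact p.Prime]
  [Algebra (ZMod p) (IsLocalRing.ResidueField A)] {d : ℕ} {α : L}

theorem exists_rat_mul_add_eq {a b : ℚ} (h : a ≠ 0 ∨ b ≠ 0) :
    ∃ (q : ℚ) (m n : ℤ), q ≠ 0 ∧ IsCoprime m n ∧ a = q * m ∧ b = q * n := by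
  have hg : ((Int.gcd (a.num * b.den) (b.num * a.den) : ℕ) : ℚ) ≠ 0 := by
    rw [Nat.cast_ne_zero, Ne, Int.gcd_eq_zero_iff]
    rintro ⟨h1, h2⟩
    have h1 : a = 0 := by simpa using h1
    have h2 : b = 0 := by simpa using h2
    tauto
  obtain ⟨g, m, n, hg0, hco, hm, hn⟩ := Int.exists_gcd_one'
    (m := a.num * b.den) (n := b.num * a.den) (Nat.pos_of_ne_zero (by exact_mod_cast hg))
  have hg' : (g : ℚ) ≠ 0 := by exact_mod_cast hg0.ne'
  have ha : (a.den : ℚ) ≠ 0 := by exact_mod_cast a.den_ne_zero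
  have hb : (b.den : ℚ) ≠ 0 := by exact_mod_cast b.den_ne_zero
  refine ⟨g / (a.den * b.den), m, n, by positivity, Int.isCoprime_iff_gcd_eq_one.2 hco, ?_, ?_⟩
  · have : (a.num : ℚ) * b.den = m * g := by exact_mod_cast hm
    rw [div_mul_eq_mul_div, eq_div_iff (by positivity)]
    linear_combination this + b.den * Rat.mul_den_eq_num a
  · have : (b.num : ℚ) * a.den = n * g := by exact_mod_cast hn
    rw [div_mul_eq_mul_div, eq_div_iff (by positivity)]
    linear_combination this + a.den * Rat.mul_den_eq_num b

include hA in
-- Write `a + bα = q(m + nα)` with `m`, `n` coprime. One of `m ± nα` is a unit: otherwise `2m` and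
-- `2nα` are nonunits, so `p` divides both `m` and `n`.
theorem exists_rat_mul_unit_or_div_unit (hp2 : p ≠ 2) (hα : α ^ 2 = -(d : L)) (hd : p.Coprime d)
    {a b : ℚ} (h : (a + b * α : L) ≠ 0) :
    ∃ (q : ℚ) (m n : ℤ), V (m + n * α) = 1 ∧
      ((a + b * α : L) = q * (m + n * α) ∨ (a + b * α : L) = q / (m + n * α)) := by
  have hpp : p.Prime := Fact.out
  have hab : a ≠ 0 ∨ b ≠ 0 := by
    by_contra! hab
    simp [hab.1, hab.2] at h
  obtain ⟨q, m, n, hq, hco, rfl, rfl⟩ := exists_rat_mul_add_eq hab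
  have hint (n : ℤ) : V n ≤ 1 := (ReducesTo.intCast n).valuation_le_one hA
  have hVα : V α = 1 := by
    have h1 : V ((d : ℤ) : L) = 1 := (valuation_intCast_eq_one_iff hA (p := p)).2 fun h ↦
      hpp.one_lt.ne' (Nat.eq_one_of_dvd_coprimes hd dvd_rfl (Int.natCast_dvd_natCast.1 h))
    have h2 : V α ^ 2 = 1 := by
      rw [← map_pow, hα, Valuation.map_neg, ← h1, Int.cast_natCast]
    exact (pow_eq_one_iff_of_nonneg zero_le two_ne_zero).1 h2
  have hle (n' : ℤ) : V (m + n' * α) ≤ 1 :=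
    (V.map_add _ _).trans (max_le (hint m) (by rw [map_mul, hVα, mul_one]; exact hint n'))
  by_cases h1 : V (m + n * α) = 1
  · exact ⟨q, m, n, h1, .inl (by push_cast; ring)⟩
  have hneg : V (m + (-n : ℤ) * α) = 1 := by
    by_contra h2
    have hlt1 := lt_of_le_of_ne (hle n) h1
    have hlt2 := lt_of_le_of_ne (hle _) h2
    have h2V : V ((2 : ℤ) : L) = 1 := (valuation_intCast_eq_one_iff hA (p := p)).2 fun h ↦
      hp2 ((Nat.prime_dvd_prime_iff_eq hpp Nat.prime_two).1 (by exact_mod_cast h))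
    have hm : V m < 1 := by
      have := V.map_add_lt hlt1 hlt2
      rwa [show (m + n * α + (m + (-n : ℤ) * α) : L) = (2 : ℤ) * m by push_cast; ring, map_mul,
        h2V, one_mul] at this
    have hn : V n < 1 := by
      have := V.map_sub_lt hlt1 hlt2
      rwa [show (m + n * α - (m + (-n : ℤ) * α) : L) = (2 : ℤ) * n * α by push_cast; ring, map_mul,
        map_mul, h2V, one_mul, hVα, mul_one] at this
    have hpm : (p : ℤ) ∣ m := by
      by_contra h
      exact hm.ne ((valuation_intCast_eq_one_iff hA).2 h)
    have hpn : (p : ℤ) ∣ n := by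
      by_contra h
      exact hn.ne ((valuation_intCast_eq_one_iff hA).2 h)
    have := hco.isUnit_of_dvd' hpm hpn
    rw [Int.isUnit_iff_natAbs_eq, Int.natAbs_natCast] at this
    exact hpp.one_lt.ne' this
  have hne : (m + (-n : ℤ) * α : L) ≠ 0 := by
    intro h
    rw [h, map_zero] at hneg
    exact zero_ne_one hneg
  -- `m² + dn²` is the norm `(m + nα)(m - nα)`.
  refine ⟨q * (m ^ 2 + d * n ^ 2), m, -n, hneg, .inr ?_⟩
  rw [eq_div_iff hne]
  push_cast
  linear_combination -q * n ^ 2 * hα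

variable (hα : α ^ 2 = -(d : L)) (hd : p.Coprime d) (hp2 : p ≠ 2)
  (hdense : ∀ x : L, x ≠ 0 → ∃ a b : ℚ, V (x - (a + b * α)) < V x)

include hA hα hd hp2 hdense

/-- This is unramifiedness: up to a unit, a good approximation `a + bα` of `x` is a rational number.
-/
theorem exists_valuation_eq_zpow {x : L} (hx : x ≠ 0) : ∃ j : ℤ, V x = V p ^ j := by
  obtain ⟨a, b, hab⟩ := hdense x hx
  have hV : V (a + b * α) = V x := V.map_eq_of_sub_lt (by rwa [V.map_sub_swap])
  have hne : (a + b * α : L) ≠ 0 := by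
    rw [← V.ne_zero_iff, hV, V.ne_zero_iff]
    exact hx
  obtain ⟨q, m, n, h1, hq⟩ := exists_rat_mul_unit_or_div_unit hA hp2 hα hd hne
  have hVq : V x = V q := by
    rw [← hV]
    rcases hq with hq | hq <;> rw [hq] <;> simp [h1]
  have hq0 : q ≠ 0 := by
    rintro rfl
    apply hx
    rw [← V.zero_iff, hVq]
    simp
  rw [hVq]
  exact valuation_ratCast_eq_zpow hA hq0

/-- Every nonzero residue class has the form `c(m + nβ)^(±1)` with `c ∈ 𝔽_p`, so a power of
Frobenius that fixes `β` fixes everything. -/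
theorem pow_card_eq_self_of_reducesTo {β : IsLocalRing.ResidueField A} (hβ : A.ReducesTo α β)
    {i : ℕ} (hi : β ^ p ^ i = β) (z : IsLocalRing.ResidueField A) : z ^ p ^ i = z := by
  have hpp : p.Prime := Fact.out
  have : CharP (IsLocalRing.ResidueField A) p :=
    charP_of_injective_algebraMap (algebraMap (ZMod p) _).injective p
  by_cases hz : z = 0
  · rw [hz, zero_pow (pow_ne_zero _ hpp.ne_zero)]
  have hint (n : ℤ) : (n : IsLocalRing.ResidueField A) ^ p ^ i = n := by
    rw [← iterateFrobenius_def, map_intCast]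
  obtain ⟨⟨x, hxA⟩, rfl⟩ := IsLocalRing.residue_surjective z
  have hx : A.ReducesTo x _ := ⟨hxA, rfl⟩
  generalize IsLocalRing.residue A ⟨x, hxA⟩ = z at *
  have hVx := hx.valuation_eq_one hA hz
  have hx0 : x ≠ 0 := by rintro rfl; simp at hVx
  obtain ⟨a, b, hab⟩ := hdense x hx0
  rw [hVx, ← reducesTo_zero_iff hA] at hab
  have hred := hx.sub hab
  rw [sub_sub_cancel, sub_zero] at hred
  have hne : (a + b * α : L) ≠ 0 := by
    intro h
    have := hred.valuation_eq_one hA hz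
    rw [h, map_zero] at this
    exact zero_ne_one this
  obtain ⟨q, m, n, h1, hq⟩ := exists_rat_mul_unit_or_div_unit hA hp2 hα hd hne
  have hmn := (ReducesTo.intCast (A := A) m).add ((ReducesTo.intCast n).mul hβ)
  have hmn0 := hmn.ne_zero hA h1
  have hVq : V q = 1 := by
    have := hred.valuation_eq_one hA hz
    rcases hq with hq | hq <;> rw [hq] at this <;> simpa [h1] using this
  obtain ⟨c, hc⟩ := exists_reducesTo_ratCast hA hVq.le (p := p)
  have hcp : (algebraMap (ZMod p) (IsLocalRing.ResidueField A) c) ^ p ^ i = algebraMap _ _ c := by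
    rw [← map_pow, ZMod.pow_card_pow]
  have hmnp : (m + n * β) ^ p ^ i = m + n * β := by
    rw [add_pow_char_pow, mul_pow, hint, hint, hi]
  rcases hq with hq | hq <;> rw [hq] at hred
  · rw [hred.unique (hc.mul hmn), mul_pow, hcp, hmnp]
  · rw [div_eq_mul_inv] at hred
    rw [hred.unique (hc.mul (hmn.inv hmn0)), mul_pow, inv_pow, hcp, hmnp]

end ValuationSubring

/-! ### Descent of the reduction to `𝔽_p` and reduction of the torsion point -/

namespace ValuationSubring

open WithZero WeierstrassCurve

variable {L : Type*} [Field L] [CharZero L] {V : Valuation L ℤᵐ⁰} {A : ValuationSubring L}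
  (hA : ∀ x, x ∈ A ↔ V x ≤ 1) {p : ℕ} [Fact p.Prime]
  [Algebra (ZMod p) (IsLocalRing.ResidueField A)]

omit [CharZero L] in
-- If `V x > 1`, the monic leading term strictly dominates.
theorem valuation_le_one_of_cubic {x a b : L} (ha : V a ≤ 1) (hb : V b ≤ 1)
    (h : x ^ 3 + a * x + b = 0) : V x ≤ 1 := by
  by_contra! hx
  have h1 : V x ^ 3 ≤ V x := by
    rw [← map_pow, show x ^ 3 = -(a * x + b) by linear_combination h, Valuation.map_neg]
    refine (V.map_add _ _).trans (max_le ?_ (hb.trans hx.le))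
    rw [map_mul]
    exact mul_le_of_le_one_left' ha
  exact absurd h1 (not_le.2 (lt_self_pow₀ hx (by norm_num)))

omit [CharZero L] in
include hA in
theorem valuation_le_one_of_quartic {x a b : L} (h3 : V 3 = 1) (ha : V a ≤ 1) (hb : V b ≤ 1)
    (h : 3 * x ^ 4 + 6 * a * x ^ 2 + 12 * b * x - a ^ 2 = 0) : V x ≤ 1 := by
  by_contra! hx
  have hint (n : ℤ) : V n ≤ 1 := (ReducesTo.intCast n).valuation_le_one hA
  have h6 : V 6 ≤ 1 := by exact_mod_cast hint 6
  have h12 : V 12 ≤ 1 := by exact_mod_cast hint 12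
  have hsq : V x ≤ V x ^ 2 := le_self_pow₀ hx.le (by norm_num)
  have h1 : V x ^ 4 ≤ V x ^ 2 := by
    rw [← one_mul (V x ^ 4), ← h3, ← map_pow, ← map_mul,
      show 3 * x ^ 4 = -(6 * a * x ^ 2 + (12 * b * x - a ^ 2)) by linear_combination h,
      Valuation.map_neg]
    refine (V.map_add _ _).trans (max_le ?_ ((V.map_sub _ _).trans (max_le ?_ ?_)))
    · rw [map_mul, map_mul, map_pow]
      exact mul_le_of_le_one_left' (mul_le_one' h6 ha)
    · rw [map_mul, map_mul]
      exact (mul_le_of_le_one_left' (mul_le_one' h12 hb)).trans hsq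
    · rw [map_pow]
      exact (pow_le_one' ha 2).trans (hx.le.trans hsq)
  exact absurd h1 (not_le.2 (pow_lt_pow_right₀ hx (by norm_num)))

variable (h7 : 7 ≤ p) (E : WeierstrassCurve ℚ) (W : WeierstrassCurve (IsLocalRing.ResidueField A))
  {u : L} (hu0 : u ≠ 0) (hu : ∃ j : ℤ, V u = V p ^ j)
  (h4 : A.ReducesTo (u ^ 4 * (E.c₄ : ℚ)) W.c₄) (h6 : A.ReducesTo (u ^ 6 * (E.c₆ : ℚ)) W.c₆)

include hA h7 hu0 hu h4 h6

/-- The scaling `u` relating `E` to its minimal model is replaced by the rational `q = p^j` of the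
same valuation. The unit `q / u` has a residue `e`, which rescales `W` to match. -/
theorem exists_shortCurve_reduction :
    ∃ (a b : ℚ) (a' b' : ZMod p) (C : VariableChange ℚ)
      (C' : VariableChange (IsLocalRing.ResidueField A)),
      C • E = shortCurve a b ∧
      C' • W = (shortCurve a' b').baseChange (IsLocalRing.ResidueField A) ∧
      A.ReducesTo a (algebraMap _ _ a') ∧ A.ReducesTo b (algebraMap _ _ b') := by
  obtain ⟨j, hj⟩ := hu
  have hp0 : (p : ℚ) ≠ 0 := by exact_mod_cast (Fact.out : p.Prime).ne_zero
  set q : ℚ := p ^ j with hq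
  have hq0 : q ≠ 0 := zpow_ne_zero _ hp0
  have hqL : (q : L) ≠ 0 := by exact_mod_cast hq0
  have hVq : V q = V u := by rw [hj, hq]; simp
  have hVe : V (q / u) = 1 := by
    rw [map_div₀, hVq, div_self (V.ne_zero_iff.2 hu0)]
  obtain ⟨e, he⟩ := exists_reducesTo hA hVe.le
  have he0 := he.ne_zero hA hVe
  have h2 : (2 : IsLocalRing.ResidueField A) ≠ 0 := by
    exact_mod_cast ofNat_ne_zero_of_zmod_algebra (k := IsLocalRing.ResidueField A) (p := p)
      two_pos (by omega)
  have h3 : (3 : IsLocalRing.ResidueField A) ≠ 0 := by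
    exact_mod_cast ofNat_ne_zero_of_zmod_algebra (k := IsLocalRing.ResidueField A) (p := p)
      three_pos (by omega)
  have h48 : (48 : IsLocalRing.ResidueField A) ≠ 0 := by
    rw [show (48 : IsLocalRing.ResidueField A) = 2 ^ 4 * 3 by norm_num]
    exact mul_ne_zero (pow_ne_zero _ h2) h3
  have h864 : (864 : IsLocalRing.ResidueField A) ≠ 0 := by
    rw [show (864 : IsLocalRing.ResidueField A) = 2 ^ 5 * 3 ^ 3 by norm_num]
    exact mul_ne_zero (pow_ne_zero _ h2) (pow_ne_zero _ h3)
  obtain ⟨C, hC⟩ := exists_variableChange_eq_shortCurve two_ne_zero three_ne_zero E hq0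
  obtain ⟨C', hC'⟩ := exists_variableChange_eq_shortCurve h2 h3 W he0
  have ha : A.ReducesTo ((-(q ^ 4 * E.c₄) / 48 : ℚ) : L) (-(e ^ 4 * W.c₄) / 48) := by
    have := (((he.pow 4).mul h4).neg).mul ((ReducesTo.ofNat 48).inv h48)
    rw [← div_eq_mul_inv, ← div_eq_mul_inv] at this
    convert this using 1
    push_cast
    field_simp
  have hb : A.ReducesTo ((-(q ^ 6 * E.c₆) / 864 : ℚ) : L) (-(e ^ 6 * W.c₆) / 864) := by
    have := (((he.pow 6).mul h6).neg).mul ((ReducesTo.ofNat 864).inv h864)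
    rw [← div_eq_mul_inv, ← div_eq_mul_inv] at this
    convert this using 1
    push_cast
    field_simp
  obtain ⟨a', ha'⟩ := exists_reducesTo_ratCast hA (ha.valuation_le_one hA) (p := p)
  obtain ⟨b', hb'⟩ := exists_reducesTo_ratCast hA (hb.valuation_le_one hA) (p := p)
  refine ⟨_, _, a', b', C, C', hC, ?_, ha', hb'⟩
  rw [baseChange_shortCurve, ← ha.unique ha', ← hb.unique hb', hC']

variable [DecidableEq (IsLocalRing.ResidueField A)] [E.IsElliptic] [W.IsElliptic]
  (hk : ∀ z : IsLocalRing.ResidueField A, z ^ p ^ 2 = z)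

include hk

/-- Only the root of the cubic is reduced, not the group law: its integrality makes it a root over
`𝔽_p`. -/
theorem not_exists_torsion_reduction_of_two_torsion
    (htors : ∃ P : E.toAffine.Point, P ≠ 0 ∧ 2 • P = 0) :
    ¬ ∃ P : W.toAffine.Point, P ≠ 0 ∧ p • P = 0 := by
  intro h
  obtain ⟨a, b, a', b', C, C', hC, hC', ha, hb⟩ :=
    exists_shortCurve_reduction hA h7 E W hu0 hu h4 h6
  have htors := exists_torsion_variableChange C E htors
  have h := exists_torsion_variableChange C' W h
  have hell : (C' • W).IsElliptic := inferInstance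
  rw [hC] at htors
  rw [hC'] at h hell
  obtain ⟨x, hx⟩ := exists_of_shortCurve_two_torsion two_ne_zero htors
  have hxL : (x : L) ^ 3 + a * x + b = 0 := by exact_mod_cast hx
  have hVx := valuation_le_one_of_cubic (ha.valuation_le_one hA) (hb.valuation_le_one hA) hxL
  obtain ⟨x', hx'⟩ := exists_reducesTo_ratCast hA hVx (p := p)
  refine not_exists_torsion_of_two_torsion (x₀ := x') h7 hk ?_ h
  apply (algebraMap (ZMod p) (IsLocalRing.ResidueField A)).injective
  have hred := ((hx'.pow 3).add (ha.mul hx')).add hb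
  rw [hxL] at hred
  simpa using hred.unique (by simpa using ReducesTo.intCast (A := A) 0)

theorem not_exists_torsion_reduction_of_three_torsion
    (hk1 : p % 3 = 1 → ∀ z : IsLocalRing.ResidueField A, z ^ p = z)
    (htors : ∃ P : E.toAffine.Point, P ≠ 0 ∧ 3 • P = 0) :
    ¬ ∃ P : W.toAffine.Point, P ≠ 0 ∧ p • P = 0 := by
  intro h
  obtain ⟨a, b, a', b', C, C', hC, hC', ha, hb⟩ :=
    exists_shortCurve_reduction hA h7 E W hu0 hu h4 h6
  have htors := exists_torsion_variableChange C E htors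
  have h := exists_torsion_variableChange C' W h
  have hell : (C' • W).IsElliptic := inferInstance
  rw [hC] at htors
  rw [hC'] at h hell
  obtain ⟨x, y, hxy, hx⟩ := exists_of_shortCurve_three_torsion htors
  have hxL : 3 * (x : L) ^ 4 + 6 * a * x ^ 2 + 12 * b * x - a ^ 2 = 0 := by exact_mod_cast hx
  have hyL : (y : L) ^ 2 = x ^ 3 + a * x + b := by exact_mod_cast hxy
  have hV3 : V 3 = 1 := by
    have := (valuation_intCast_eq_one_iff hA (p := p) (n := 3)).2 fun h ↦ by
      have := Int.le_of_dvd (by norm_num) h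
      omega
    exact_mod_cast this
  have hVx := valuation_le_one_of_quartic hA hV3 (ha.valuation_le_one hA)
    (hb.valuation_le_one hA) hxL
  obtain ⟨x', hx'⟩ := exists_reducesTo_ratCast hA hVx (p := p)
  have hf := ((hx'.pow 3).add (ha.mul hx')).add hb
  have hVy : V y ≤ 1 := by
    have := hf.valuation_le_one hA
    rw [← hyL, map_pow] at this
    exact (pow_le_one_iff (by norm_num)).1 this
  obtain ⟨y', hy'⟩ := exists_reducesTo_ratCast hA hVy (p := p)
  refine not_exists_torsion_of_three_torsion (x₀ := x') (y₀ := y') h7 hk hk1 ?_ ?_ h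
  · apply (algebraMap (ZMod p) (IsLocalRing.ResidueField A)).injective
    rw [← hyL] at hf
    simpa using (hy'.pow 2).unique hf
  · apply (algebraMap (ZMod p) (IsLocalRing.ResidueField A)).injective
    have hred := (((((ReducesTo.ofNat 3).mul (hx'.pow 4)).add
      (((ReducesTo.ofNat 6).mul ha).mul (hx'.pow 2))).add
      (((ReducesTo.ofNat 12).mul hb).mul hx')).sub (ha.pow 2))
    rw [hxL] at hred
    have h0 : A.ReducesTo 0 0 := by simpa using ReducesTo.intCast (A := A) 0
    simpa only [map_sub, map_add, map_mul, map_pow, map_ofNat, map_zero] using hred.unique h0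

end ValuationSubring

theorem ZMod.isSquare_neg_three {p : ℕ} [Fact p.Prime] (hp : p % 3 = 1) :
    IsSquare (-3 : ZMod p) := by
  have hpp : p.Prime := Fact.out
  obtain ⟨g, hg⟩ := exists_prime_orderOf_dvd_card (G := (ZMod p)ˣ) 3
    (by rw [ZMod.card_units_eq_totient, Nat.totient_prime hpp]; omega)
  have h3 : (g : ZMod p) ^ 3 = 1 := by
    rw [← Units.val_pow_eq_pow_val, ← hg, pow_orderOf_eq_one, Units.val_one]
  have h1 : (g : ZMod p) ≠ 1 := by
    intro h
    rw [Units.val_eq_one] at h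
    rw [h, orderOf_one] at hg
    omega
  have h : (g : ZMod p) ^ 2 + g + 1 = 0 := by
    refine (mul_eq_zero.1 ?_).resolve_left (sub_ne_zero.2 h1)
    linear_combination h3
  -- For a primitive cube root of unity `g`, `(2g + 1)² = -3`.
  exact ⟨2 * g + 1, by linear_combination -4 * h⟩

/-! ### Completions of `K` and the main theorem -/

namespace Ridgdill

/-- Every factor is a power of a prime, and a `finprod` of infinite support is `1`, so no finiteness
of the set of bad primes is required. -/
theorem conductor_ne_zero (E : WeierstrassCurve ℚ) : conductor E ≠ 0 := by
  unfold conductor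
  refine finprod_induction (fun n : ℕ ↦ n ≠ 0) one_ne_zero (fun _ _ ↦ mul_ne_zero) fun p ↦ ?_
  exact pow_ne_zero _ p.2.ne_zero

theorem exists_eq_add_mul {d : ℕ} {K : Type*} [Field K] [NumberField K] {α : K}
    (hα : α ^ 2 = -(d : K)) (hK : IntermediateField.adjoin ℚ {α} = ⊤) (x : K) :
    ∃ a b : ℚ, x = a + b * α := by
  have hx : x ∈ (IntermediateField.adjoin ℚ {α}).toSubalgebra := by rw [hK]; trivial
  rw [IntermediateField.adjoin_simple_toSubalgebra_of_isAlgebraic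
    (Algebra.IsAlgebraic.isAlgebraic α)] at hx
  induction hx using Algebra.adjoin_induction with
  | mem x hx => exact ⟨0, 1, by simpa using hx⟩
  | algebraMap r => exact ⟨r, 0, by simp⟩
  | add x y _ _ hx hy =>
    obtain ⟨a, b, rfl⟩ := hx
    obtain ⟨a', b', rfl⟩ := hy
    exact ⟨a + a', b + b', by push_cast; ring⟩
  | mul x y _ _ hx hy =>
    obtain ⟨a, b, rfl⟩ := hx
    obtain ⟨a', b', rfl⟩ := hy
    refine ⟨a * a' - d * (b * b'), a * b' + b * a', ?_⟩
    push_cast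
    linear_combination b * b' * hα

section Local

open WithZero ValuationSubring

variable {K : Type*} [Field K] [NumberField K] (v : HeightOneSpectrum (𝓞 K))

instance : CharZero (v.adicCompletion K) :=
  charZero_of_injective_algebraMap (algebraMap K (v.adicCompletion K)).injective

/-- Density of `K` in its completion; the error is measured relative to `x`, so that `y` has the
valuation of `x`. -/
theorem exists_valued_sub_algebraMap_lt {x : v.adicCompletion K} (hx : x ≠ 0) :
    ∃ y : K, (Valued.v (x - algebraMap K (v.adicCompletion K) y) : ℤᵐ⁰) < Valued.v x := by
  have hx' : Valued.v.restrict x ≠ 0 := by simpa using hx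
  have hmem : {y | (Valued.v (y - x) : ℤᵐ⁰) < Valued.v x} ∈ nhds x :=
    Valued.mem_nhds.2 ⟨Units.mk0 _ hx', fun y hy ↦ Valued.v.restrict_lt_iff.mp hy⟩
  obtain ⟨y, hy⟩ := (HeightOneSpectrum.denseRange_algebraMap K v).mem_nhds hmem
  exact ⟨y, by rwa [Valuation.map_sub_swap]⟩

theorem valued_natCast_lt_one {p : ℕ} (hp : (p : 𝓞 K) ∈ v.asIdeal) :
    (Valued.v (p : v.adicCompletion K) : ℤᵐ⁰) < 1 := by
  have h := HeightOneSpectrum.valuedAdicCompletion_eq_valuation (K := K) v (p : 𝓞 K)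
  have hcast : algebraMap (𝓞 K) (v.adicCompletion K) (p : 𝓞 K) = p := map_natCast _ p
  rw [← hcast]
  exact h.trans_lt ((HeightOneSpectrum.valuation_lt_one_iff_mem v _).2 hp)

theorem charP_residueField {p : ℕ} (hpp : p.Prime) (hp : (p : 𝓞 K) ∈ v.asIdeal) :
    CharP (IsLocalRing.ResidueField (v.adicCompletionIntegers K)) p := by
  have h0 := (reducesTo_zero_iff (A := v.adicCompletionIntegers K) (V := Valued.v)
    (fun _ ↦ Iff.rfl)).2 (valued_natCast_lt_one v hp)
  have h := CharP.ringChar_of_prime_eq_zero hpp ((ReducesTo.natCast p).unique h0)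
  exact h ▸ ringChar.charP _

theorem exists_reductionAt_c₄_c₆ (E : WeierstrassCurve ℚ) :
    ∃ u : v.adicCompletion K, u ≠ 0 ∧
      (v.adicCompletionIntegers K).ReducesTo (u ^ 4 * (E.c₄ : ℚ))
        (reductionAt (E.baseChange K) v).c₄ ∧
      (v.adicCompletionIntegers K).ReducesTo (u ^ 6 * (E.c₆ : ℚ))
        (reductionAt (E.baseChange K) v).c₆ := by
  obtain ⟨C, hC⟩ : ∃ C : WeierstrassCurve.VariableChange (v.adicCompletion K),
      minimalAt (E.baseChange K) v = C • (E.baseChange K).baseChange (v.adicCompletion K) :=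
    ⟨_, rfl⟩
  have h4 := WeierstrassCurve.integralModel_c₄_eq (v.adicCompletionIntegers K)
    (minimalAt (E.baseChange K) v)
  have h6 := WeierstrassCurve.integralModel_c₆_eq (v.adicCompletionIntegers K)
    (minimalAt (E.baseChange K) v)
  have hc4 : (minimalAt (E.baseChange K) v).c₄ =
      ((C.u⁻¹ : (v.adicCompletion K)ˣ) : v.adicCompletion K) ^ 4 * (E.c₄ : ℚ) := by
    rw [hC, WeierstrassCurve.variableChange_c₄]
    simp [WeierstrassCurve.baseChange]
  have hc6 : (minimalAt (E.baseChange K) v).c₆ =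
      ((C.u⁻¹ : (v.adicCompletion K)ˣ) : v.adicCompletion K) ^ 6 * (E.c₆ : ℚ) := by
    rw [hC, WeierstrassCurve.variableChange_c₆]
    simp [WeierstrassCurve.baseChange]
  refine ⟨((C.u⁻¹ : (v.adicCompletion K)ˣ) : v.adicCompletion K), Units.ne_zero _, ?_, ?_⟩
  · rw [← hc4, ← h4, reductionAt, WeierstrassCurve.reduction, WeierstrassCurve.map_c₄]
    exact ⟨Subtype.property _, rfl⟩
  · rw [← hc6, ← h6, reductionAt, WeierstrassCurve.reduction, WeierstrassCurve.map_c₆]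
    exact ⟨Subtype.property _, rfl⟩

end Local

section Anomalous

open WithZero ValuationSubring

variable {K : Type*} [Field K] [NumberField K] (E : WeierstrassCurve ℚ) [E.IsElliptic]
  {d ℓ p : ℕ}

theorem not_isAnomalous (hK : IsAdjoinSqrtNeg d K)
    (htors : ∃ P : E.toAffine.Point, P ≠ 0 ∧ ℓ • P = 0) (hcase : ℓ = 2 ∨ ℓ = 3 ∧ d = 3)
    (h7 : 7 ≤ p) (hd : p.Coprime d) : ¬ IsAnomalous (E.baseChange K) p := by
  classical
  rintro ⟨hpp, hgood, v, hv, hP⟩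
  have : Fact p.Prime := ⟨hpp⟩
  have hchar := charP_residueField v hpp hv
  let : Algebra (ZMod p) (IsLocalRing.ResidueField (v.adicCompletionIntegers K)) :=
    ZMod.algebra _ p
  have hell : (reductionAt (E.baseChange K) v).IsElliptic :=
    (WeierstrassCurve.hasGoodReduction_iff_isElliptic_reduction _).1 (hgood v hv)
  obtain ⟨α, hα, hadj⟩ := hK
  have hA (x : v.adicCompletion K) : x ∈ v.adicCompletionIntegers K ↔ Valued.v x ≤ (1 : ℤᵐ⁰) :=
    Iff.rfl
  have hαL : algebraMap K (v.adicCompletion K) α ^ 2 = -(d : v.adicCompletion K) := by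
    rw [← map_pow, hα]
    simp
  have hp2 : p ≠ 2 := by omega
  have hdense (x : v.adicCompletion K) (hx : x ≠ 0) : ∃ a b : ℚ,
      (Valued.v (x - (a + b * algebraMap K (v.adicCompletion K) α)) : ℤᵐ⁰) < Valued.v x := by
    obtain ⟨y, hy⟩ := exists_valued_sub_algebraMap_lt v hx
    obtain ⟨a, b, rfl⟩ := exists_eq_add_mul hα hadj y
    exact ⟨a, b, by simpa using hy⟩
  obtain ⟨u, hu0, h4, h6⟩ := exists_reductionAt_c₄_c₆ v E
  have hu := exists_valuation_eq_zpow hA hαL hd hp2 hdense hu0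
  have hVα : (Valued.v (algebraMap K (v.adicCompletion K) α) : ℤᵐ⁰) ≤ 1 := by
    have h := (ReducesTo.natCast (A := v.adicCompletionIntegers K) d).neg.valuation_le_one hA
    rw [← hαL, map_pow] at h
    exact (pow_le_one_iff two_ne_zero).1 h
  obtain ⟨β, hβ⟩ := exists_reducesTo hA hVα
  have hβ2 : β ^ 2 = -(d : IsLocalRing.ResidueField (v.adicCompletionIntegers K)) := by
    have h := hβ.pow 2
    rw [hαL] at h
    exact h.unique (ReducesTo.natCast d).neg
  -- Frobenius fixes `β² = -d`, so it acts on `β` by a sign and its square fixes `β`.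
  have hβp : β ^ p = β ∨ β ^ p = -β := by
    rw [← sq_eq_sq_iff_eq_or_eq_neg, pow_right_comm, hβ2, ← frobenius_def, map_neg, map_natCast]
  have hβpp : β ^ p ^ 2 = β := by
    rw [sq, pow_mul]
    rcases hβp with h | h
    · rw [h, h]
    · rw [h, ← frobenius_def, map_neg, frobenius_def, h, neg_neg]
  have hk := pow_card_eq_self_of_reducesTo hA hαL hd hp2 hdense hβ hβpp
  rcases hcase with rfl | ⟨rfl, rfl⟩
  · exact not_exists_torsion_reduction_of_two_torsion hA h7 E _ hu0 hu h4 h6 hk htors hP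
  · refine not_exists_torsion_reduction_of_three_torsion hA h7 E _ hu0 hu h4 h6 hk
      (fun h1 z ↦ ?_) htors hP
    -- With `d = 3`, `β` is a square root of `-3`, which lies in `𝔽_p` when `p ≡ 1 mod 3`.
    obtain ⟨s, hs⟩ := ZMod.isSquare_neg_three h1
    have hβ1 : β ^ p ^ 1 = β := by
      have hs' : β ^ 2 = algebraMap (ZMod p) _ s ^ 2 := by
        rw [hβ2, ← map_pow, sq, ← hs, map_neg, map_ofNat, Nat.cast_ofNat]
      rw [pow_one]
      rcases sq_eq_sq_iff_eq_or_eq_neg.1 hs' with h | h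
      · rw [h, ← map_pow, ZMod.pow_card]
      · rw [h, ← map_neg, ← map_pow, ZMod.pow_card]
    simpa using pow_card_eq_self_of_reducesTo hA hαL hd hp2 hdense hβ hβ1 z

end Anomalous

end Ridgdill

theorem mainTheorem12 (E : WeierstrassCurve ℚ) [E.IsElliptic]
    (d : ℕ) (hd : 0 < d) (K : Type*) [Field K] [NumberField K]
    (hK : Ridgdill.IsAdjoinSqrtNeg d K)
    (ℓ : ℕ) (hℓ : ℓ.Prime)
    (htors : ∃ P : E.toAffine.Point, P ≠ 0 ∧ ℓ • P = 0)
    (hcase : ℓ = 2 ∨ (ℓ = 3 ∧ Ridgdill.IsAdjoinSqrtNeg 3 K)) :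
    Ridgdill.IsRidgdill E K ∧
      ∀ p : ℕ, p.Prime → 7 ≤ p → p.Coprime (Ridgdill.conductor E * d) →
        ¬ Ridgdill.IsAnomalous (E.baseChange K) p := by
  have main (p : ℕ) (hp : p.Prime) (h7 : 7 ≤ p) (hco : p.Coprime (Ridgdill.conductor E * d)) :
      ¬ Ridgdill.IsAnomalous (E.baseChange K) p := by
    rcases hcase with rfl | ⟨rfl, hK3⟩
    · exact Ridgdill.not_isAnomalous E hK htors (.inl rfl) h7 (hco.coprime_dvd_right ⟨_, mul_comm _ _⟩)
    -- Here `K` is presented with `3` in place of `d`, so the coprimality needed is only `p ≠ 3`.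
    · exact Ridgdill.not_isAnomalous E hK3 htors (.inr ⟨rfl, rfl⟩) h7
        ((Nat.coprime_primes hp Nat.prime_three).2 (by omega))
  refine ⟨?_, main⟩
  have hN : Ridgdill.conductor E * d ≠ 0 := mul_ne_zero (Ridgdill.conductor_ne_zero E) hd.ne'
  -- A prime larger than `N_E d ≠ 0` is coprime to it.
  refine (Set.finite_Iic (max 7 (Ridgdill.conductor E * d))).subset fun p hp ↦ ?_
  by_contra hlt
  simp only [Set.mem_Iic, not_le, max_lt_iff] at hlt
  refine main p hp.1 hlt.1.le ((Nat.Prime.coprime_iff_not_dvd hp.1).2 fun h ↦ ?_) hp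
  exact absurd (Nat.le_of_dvd (Nat.pos_of_ne_zero hN) h) (not_le.2 hlt.2)
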